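/- Let $\mathcal V$ be a finite or countably infinite set of vertices and let $k\ge 1$. A $k$-hypergraph on $\mathcal V$ is a function $g:\mathcal V^k\to\{0,1\}$, and a $k$-distinguishing class is a non-empty set $\mathcal G$ of $k$-hypergraphs that are undirected, i.e. invariant under permutations of their $k$ arguments. For a probability distribution $p$ on $\mathcal V$ let $L_p(g)=\mathbb E_{v_1,\dots,v_k\sim p\ \mathrm{iid}}[g(v_1,\dots,v_k)]$, and for a sample $S=(s_1,\dots,s_m)$ let $L_S(g)=m^{-k}\sum_{i_1,\dots,i_k=1}^m g(s_{i_1},\dots,s_{i_k})$. Let $\mathrm{IPM}_{\mathcal G}(p_1,p_2)=\sup_{g\in\mathcal G}|L_{p_1}(g)-L_{p_2}(g)|$. The graph VC dimension $\mathrm{gVC}(\mathcal G)$ is the VC dimension of $\mathcal G$ if $k=1$, and $\mathrm{gVC}(\mathcal G)=\sup_{v\in\mathcal V}\mathrm{gVC}(\{g(v,\cdot,\dots,\cdot):g\in\mathcal G\})$ if $k>1$. An algorithm $A$, which maps a pair of finite samples $(S_1,S_2)$ of vertices to an element $A(S_1,S_2)$ of $\mathcal G$, discriminates with accuracy $\varepsilon$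 and confidence $\delta$ from more than $M$ samples if for all probability distributions $p_1,p_2$ on $\mathcal V$ and all sizes $m_1,m_2>M$, when $S_1\sim p_1^{m_1}$ and $S_2\sim p_2^{m_2}$ are independent, with probability at least $1-\delta$ the output $g=A(S_1,S_2)$ satisfies \[|L_{p_1}(g)-L_{p_2}(g)|>\mathrm{IPM}_{\mathcal G}(p_1,p_2)-\varepsilon .\] The sample complexity $m_{\mathcal G}(\varepsilon,\delta)$ of $\mathcal G$ is the smallest $m\in\mathbb N$ for which some algorithm discriminates with accuracy $\varepsilon$ and confidence $\delta$ from more than $m$ samples ($\infty$ if there is none). Theorem (Sample complexity, upper bound). There is an absolute constant $C>0$ such that for every finite or countable $\mathcal V$, every $k\ge 1$ and every $k$-distinguishing class $\mathcal G$ on $\mathcal V$ with $\mathrm{gVC}(\mathcal G)=\rho<\infty$, the following holds. 1. For all $\varepsilon>0$ and $0<\delta\le 1/2$, \[m_{\mathcal G}(\varepsilon,\delta)\le C\,\frac{\rho k^2}{\varepsilon^2}\log\frac1\delta .\] 2. There is an empirical IPM maximizer, that is, an algorithm whose output always belongs to $\mathcal G$ and maximizes $|L_{S_1}(g)-L_{S_2}(g)|$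 over $g\in\mathcal G$; and every empirical IPM maximizer discriminates, for all $\varepsilon>0$ and $0<\delta\le 1/2$, with accuracy $\varepsilon$ and confidence $\delta$ from more than $C\frac{\rho k^2}{\varepsilon^2}\log\frac1\delta$ samples. -/

import Mathlib

open MeasureTheory
open scoped ENNReal

noncomputable section

namespace GraphDisc

/-- A `k`-hypergraph on the vertex set `V` is identified with its set of hyperedges, a set of
`k`-tuples of vertices. It is undirected if that set is invariant under permuting the entries of
the tuples. -/
def Undirected {V : Type*} {k : ℕ} (g : Set (Fin k → V)) : Prop :=
  ∀ (π : Equiv.Perm (Fin k)) (v : Fin k → V), (fun i => v (π i)) ∈ g ↔ v ∈ g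

/-- A `k`-distinguishing class is a collection of undirected `k`-hypergraphs on `V`. -/
def IsDistinguishingClass {V : Type*} {k : ℕ} (G : Set (Set (Fin k → V))) : Prop :=
  ∀ g ∈ G, Undirected g

/-- The family `D` of subsets of `α` shatters the finite set `S`: every subset of `S` is the trace
on `S` of a member of `D`. -/
def ShattersSet {α : Type*} (D : Set (Set α)) (S : Finset α) : Prop :=
  ∀ T : Set α, T ⊆ S → ∃ d ∈ D, d ∩ S = T

/-- The VC dimension: the supremum of the sizes of the finite shattered sets. -/
def VCdim {α : Type*} (D : Set (Set α)) : ℕ∞ :=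
  ⨆ (S : Finset α) (_ : ShattersSet D S), (S.card : ℕ∞)

/-- The `k`-hypergraph `g_v` obtained from a `(k+1)`-hypergraph `g` by fixing the first entry of
the tuples to be `v`. -/
def fixFirst {V : Type*} {k : ℕ} (v : V) (g : Set (Fin (k + 1) → V)) : Set (Fin k → V) :=
  {u | (Fin.cons v u : Fin (k + 1) → V) ∈ g}

/-- The graph VC dimension of a family of `k`-hypergraphs. For `k = 1` it is the VC dimension of
the family of subsets of `V` that are identified with the `1`-hypergraphs of the family; for
larger `k` it is the supremum over `v` of the graph VC dimension of `{g_v : g ∈ G}`. The case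
`k = 0` is a placeholder. -/
def gVC {V : Type*} : (k : ℕ) → Set (Set (Fin k → V)) → ℕ∞
  | 0, _ => 0
  | 1, G => VCdim ((fun g : Set (Fin 1 → V) => {x : V | (fun _ => x) ∈ g}) '' G)
  | k + 2, G => ⨆ v : V, gVC (k + 1) (fixFirst v '' G)

/-- The frequency of an edge of `g` with respect to `p`: the probability that `k` independent
draws from `p` form a hyperedge. -/
def edgeFreq {V : Type*} [MeasurableSpace V] {k : ℕ} (p : Measure V) (g : Set (Fin k → V)) : ℝ :=
  (Measure.pi (fun _ : Fin k => p)).real g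

/-- The empirical frequency of an edge of `g` in the sample `S`: the average of the indicator of
`g` over the `m ^ k` tuples of (not necessarily distinct) sample points. -/
def empFreq {V : Type*} {k m : ℕ} (S : Fin m → V) (g : Set (Fin k → V)) : ℝ :=
  (∑ i : Fin k → Fin m, g.indicator (fun _ => (1 : ℝ)) (fun j => S (i j))) / (m : ℝ) ^ k

/-- The integral probability metric induced by `G`. -/
def IPM {V : Type*} [MeasurableSpace V] {k : ℕ} (G : Set (Set (Fin k → V)))
    (p₁ p₂ : Measure V) : ℝ :=
  ⨆ g : G, |edgeFreq p₁ (g : Set (Fin k → V)) - edgeFreq p₂ (g : Set (Fin k → V))|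

/-- A rule that takes two finite samples of vertices to a `k`-hypergraph. -/
abbrev Algo (V : Type*) (k : ℕ) : Type _ :=
  ∀ m₁ m₂ : ℕ, (Fin m₁ → V) → (Fin m₂ → V) → Set (Fin k → V)

/-- The rule `A` outputs members of `G`, and whenever the two samples are drawn IID from `p₁` and
`p₂` and both have size larger than `M`, then with probability at least `1 - δ` the output `g`
satisfies `|L_{p₁}(g) - L_{p₂}(g)| > IPM_G(p₁, p₂) - ε`. -/
def Discriminates {V : Type*} [MeasurableSpace V] {k : ℕ} (G : Set (Set (Fin k → V)))
    (A : Algo V k) (ε δ M : ℝ) : Prop :=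
  (∀ (m₁ m₂ : ℕ) (S₁ : Fin m₁ → V) (S₂ : Fin m₂ → V), A m₁ m₂ S₁ S₂ ∈ G) ∧
  ∀ (p₁ p₂ : Measure V), IsProbabilityMeasure p₁ → IsProbabilityMeasure p₂ →
    ∀ m₁ m₂ : ℕ, M < m₁ → M < m₂ →
      1 - δ ≤ ((Measure.pi (fun _ : Fin m₁ => p₁)).prod (Measure.pi (fun _ : Fin m₂ => p₂))).real
        {S : (Fin m₁ → V) × (Fin m₂ → V) |
          IPM G p₁ p₂ - ε <
            |edgeFreq p₁ (A m₁ m₂ S.1 S.2) - edgeFreq p₂ (A m₁ m₂ S.1 S.2)|}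

/-- The sample complexity of the class `G` at accuracy `ε` and confidence `δ`: the smallest `m`
that suffices for some rule; `⊤` if there is none. -/
def sampleComplexity {V : Type*} [MeasurableSpace V] {k : ℕ} (G : Set (Set (Fin k → V)))
    (ε δ : ℝ) : ℕ∞ :=
  ⨅ (m : ℕ) (_ : ∃ A : Algo V k, Discriminates G A ε δ m), (m : ℕ∞)

/-- The rule `A` always outputs a member of `G` at which the empirical discrepancy
`|L_{S₁}(g) - L_{S₂}(g)|` is maximal over `G`. -/
def IsEmpiricalMaximizer {V : Type*} {k : ℕ} (G : Set (Set (Fin k → V))) (A : Algo V k) : Prop :=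
  ∀ (m₁ m₂ : ℕ) (S₁ : Fin m₁ → V) (S₂ : Fin m₂ → V),
    A m₁ m₂ S₁ S₂ ∈ G ∧
      ∀ g ∈ G, |empFreq S₁ g - empFreq S₂ g| ≤
        |empFreq S₁ (A m₁ m₂ S₁ S₂) - empFreq S₂ (A m₁ m₂ S₁ S₂)|

end GraphDisc

end

/-!
The deviation `sup_g |L_p(g) - L_S(g)|` is bounded by recursion on `k`. Integrating out the first
vertex against `p` leaves a class of `(k - 1)`-hypergraphs. The remaining term compares, for each
tuple `i` of sample indices, the measure and the empirical frequency of the set of vertices that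
complete `S ∘ i` to a hyperedge; by undirectedness the VC dimension of these sets is at most the
graph VC dimension. The sets depend on the sample, but only through at most `k - 1` of its points,
so resampling those points decouples them at the price of an error `k / m`. Symmetrization, chaining
and Haussler's packing bound then give `O(√(d / m))` without a logarithm, hence an expected
deviation `O(k √(d / m))` after `k` steps of the recursion. Replacing one sample point changes the
deviation by at most `k / m`, so McDiarmid's inequality yields concentration.
-/

namespace GraphDisc

open Finset
open scoped BigOperators symmDiff

theorem sum_choose_le_exp_mul_div_pow {l d : ℕ} (hd : 1 ≤ d) (hdl : d ≤ l) :
    ∑ k ∈ Iic d, (l.choose k : ℝ) ≤ (Real.exp 1 * l / d) ^ d := by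
  have : (0 : ℝ) < d := by exact_mod_cast hd
  have hl0 : (0 : ℝ) < l := by exact_mod_cast hd.trans hdl
  set t : ℝ := d / l with ht
  have ht0 : 0 < t := by positivity
  have ht1 : t ≤ 1 := by rw [ht, div_le_one hl0]; exact_mod_cast hdl
  have weighted : t ^ d * ∑ k ∈ Iic d, (l.choose k : ℝ) ≤ Real.exp d := calc
    t ^ d * ∑ k ∈ Iic d, (l.choose k : ℝ) ≤ ∑ k ∈ Iic d, t ^ k * (l.choose k : ℝ) := by
      rw [mul_sum]
      refine sum_le_sum fun k hk => mul_le_mul_of_nonneg_right ?_ (Nat.cast_nonneg _)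
      exact pow_le_pow_of_le_one ht0.le ht1 (mem_Iic.1 hk)
    _ ≤ ∑ k ∈ range (l + 1), t ^ k * (l.choose k : ℝ) := by
      refine sum_le_sum_of_subset_of_nonneg (fun k hk => ?_) fun _ _ _ => by positivity
      simp only [mem_Iic, mem_range] at hk ⊢
      lia
    _ = (t + 1) ^ l := by simp [add_pow]
    _ ≤ Real.exp t ^ l := by gcongr; exact Real.add_one_le_exp t
    _ = Real.exp d := by rw [← Real.exp_nat_mul, ht]; congr 1; field_simp
  have hpow : (Real.exp 1 * l / d) ^ d = Real.exp d / t ^ d := by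
    rw [← Real.exp_one_pow d, ← div_pow, ht]
    congr 1
    field_simp
  rwa [hpow, le_div_iff₀ (by positivity), mul_comm]

theorem le_two_mul_log_of_le_log_mul {c x : ℝ} (hc : 0 < c) (hx : 0 < x)
    (h : x ≤ Real.log (c * x)) : x ≤ 2 * Real.log c := by
  have hlog : Real.log (x / 2) ≤ x / 2 - 1 := Real.log_le_sub_one_of_pos (by positivity)
  rw [Real.log_div hx.ne' two_ne_zero] at hlog
  rw [Real.log_mul hc.ne' hx.ne'] at h
  linarith [Real.log_two_lt_d9]

theorem card_le_VCdim {V : Type*} {D : Set (Set V)} {S : Finset V} (hS : ShattersSet D S) :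
    #S ≤ VCdim D :=
  le_iSup₂ (f := fun (S : Finset V) (_ : ShattersSet D S) => (#S : ℕ∞)) S hS

theorem exists_subset_pairwise_forall_exists_not {α : Type*} {r : α → α → Prop}
    (symm : ∀ a b, r a b → r b a) (irrefl : ∀ a, ¬ r a a) (A : Finset α) :
    ∃ B ⊆ A, (B : Set α).Pairwise r ∧ ∀ a ∈ A, ∃ b ∈ B, ¬ r b a := by
  classical
  obtain ⟨B, hB, hmax⟩ := exists_max_image
    (A.powerset.filter fun B : Finset α => (B : Set α).Pairwise r) card ⟨∅, by simp⟩
  simp only [mem_filter, mem_powerset, and_imp] at hB hmax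
  refine ⟨B, hB.1, hB.2, fun a ha => ?_⟩
  by_contra! hr
  have ha_notMem : a ∉ B := fun haB => irrefl a (hr a haB)
  have hle := hmax (insert a B) (insert_subset ha hB.1) (by
    rw [coe_insert]
    exact hB.2.insert fun b hb _ => ⟨symm b a (hr b hb), hr b hb⟩)
  rw [card_insert_of_notMem ha_notMem] at hle
  lia

section Traces

variable {V Γ ι κ : Type*} [Fintype ι]

/-- The trace of the set `A` on the sample `z`, as the set of the indices of the sample points
that lie in `A`. -/
noncomputable def trace (z : ι → V) (A : Set V) : Finset ι :=
  open scoped Classical in {i | z i ∈ A}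

@[simp]
theorem mem_trace {z : ι → V} {A : Set V} {i : ι} : i ∈ trace z A ↔ z i ∈ A := by
  simp [trace]

theorem trace_trace [Fintype κ] (z : ι → V) (f : κ → ι) (A : Set V) :
    trace f (trace z A : Set ι) = trace (z ∘ f) A := by
  ext; simp

/-- The set of the traces on the sample `z` of the members of the family `D`. -/
noncomputable def traces (D : Γ → Set V) (z : ι → V) : Finset (Finset ι) :=
  open scoped Classical in {T | ∃ a, trace z (D a) = T}

@[simp]
theorem mem_traces {D : Γ → Set V} {z : ι → V} {T : Finset ι} :
    T ∈ traces D z ↔ ∃ a, trace z (D a) = T := by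
  simp [traces]

variable {D : Γ → Set V} {z : ι → V} {d : ℕ}

theorem injOn_of_shatters_traces [DecidableEq ι] {s : Finset ι} (hs : (traces D z).Shatters s) :
    Set.InjOn z s := by
  intro i hi j hj hij
  obtain ⟨T, hT, hsT⟩ := hs.exists_inter_eq_singleton hi
  obtain ⟨a, rfl⟩ := mem_traces.1 hT
  have hiT : i ∈ s ∩ trace z (D a) := by simp [hsT]
  have hjT : j ∈ s ∩ trace z (D a) := by
    rw [mem_inter, mem_trace] at hiT ⊢
    exact ⟨hj, hij ▸ hiT.2⟩
  rw [hsT, mem_singleton] at hjT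
  exact hjT.symm

theorem shattersSet_image_of_shatters_traces [DecidableEq ι] [DecidableEq V]
    {s : Finset ι} (hs : (traces D z).Shatters s) : ShattersSet (Set.range D) (s.image z) := by
  classical
  intro T hT
  obtain ⟨U, hU, hsU⟩ := hs (filter_subset (fun i => z i ∈ T) s)
  obtain ⟨a, rfl⟩ := mem_traces.1 hU
  have mem_iff (i : ι) (hi : i ∈ s) : z i ∈ D a ↔ z i ∈ T := by
    simpa [hi] using Finset.ext_iff.1 hsU i
  refine ⟨D a, ⟨a, rfl⟩, Set.ext fun x => ⟨?_, fun hx => ⟨?_, hT hx⟩⟩⟩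
  · rintro ⟨hx, hxs⟩
    obtain ⟨i, hi, rfl⟩ := mem_image.1 (mem_coe.1 hxs)
    exact (mem_iff i hi).1 hx
  · obtain ⟨i, hi, rfl⟩ := mem_image.1 (mem_coe.1 (hT hx))
    exact (mem_iff i hi).2 hx

theorem vcDim_traces_le [DecidableEq ι] (hD : VCdim (Set.range D) ≤ d) (z : ι → V) :
    (traces D z).vcDim ≤ d := by
  classical
  refine Finset.sup_le fun s hs => ?_
  have hsh := mem_shatterer.1 hs
  have hcard := card_le_VCdim (shattersSet_image_of_shatters_traces hsh)
  rw [card_image_of_injOn (injOn_of_shatters_traces hsh)] at hcard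
  exact_mod_cast hcard.trans hD

theorem card_traces_le_sum_choose (hD : VCdim (Set.range D) ≤ d) (z : ι → V) :
    #(traces D z) ≤ ∑ k ∈ Iic d, (Fintype.card ι).choose k := by
  classical
  exact (card_le_card_shatterer _).trans <| card_shatterer_le_sum_vcDim.trans <|
    sum_le_sum_of_subset (Iic_subset_Iic.2 (vcDim_traces_le hD z))

theorem log_card_le_mul_log_of_injOn_trace (hd : 1 ≤ d) (hD : VCdim (Set.range D) ≤ d)
    {l : ℕ} {B : Finset (Finset ι)} (hne : B.Nonempty) (hBz : B ⊆ traces D z) (hdl : d ≤ l)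
    {f : Fin l → ι} (hf : Set.InjOn (fun T : Finset ι => trace f (T : Set ι)) B) :
    Real.log #B ≤ d * Real.log (Real.exp 1 * l / d) := by
  have hcard : #B ≤ #(traces D (z ∘ f)) := by
    refine card_le_card_of_injOn _ (fun T hT => ?_) hf
    obtain ⟨a, rfl⟩ := mem_traces.1 (hBz hT)
    exact mem_traces.2 ⟨a, (trace_trace z f (D a)).symm⟩
  have hsauer : (#B : ℝ) ≤ (Real.exp 1 * l / d) ^ d := by
    refine le_trans ?_ (sum_choose_le_exp_mul_div_pow hd hdl)
    have := hcard.trans (card_traces_le_sum_choose hD (z ∘ f))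
    rw [Fintype.card_fin] at this
    exact_mod_cast this
  rw [← Real.log_pow]
  exact Real.log_le_log (by exact_mod_cast hne.card_pos) hsauer

end Traces

section Packing

variable {V Γ ι κ : Type*} [Fintype ι] [Nonempty ι] {y : ℝ} {l : ℕ}

theorem card_piFinset_compl_le [DecidableEq ι] (hy : 0 < y) {U : Finset ι}
    (hU : (Fintype.card ι : ℝ) ≤ y * #U) :
    (#(Fintype.piFinset fun _ : Fin l => Uᶜ) : ℝ) ≤
      Fintype.card ι ^ l * Real.exp (-(l / y)) := by
  have hcompl : (#Uᶜ : ℝ) ≤ Fintype.card ι * Real.exp (-(1 / y)) := calc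
    (#Uᶜ : ℝ) = Fintype.card ι - #U := by rw [card_compl, Nat.cast_sub (card_le_univ _)]
    _ ≤ Fintype.card ι - Fintype.card ι / y := by
      gcongr
      rwa [div_le_iff₀' hy]
    _ = Fintype.card ι * (-(1 / y) + 1) := by ring
    _ ≤ Fintype.card ι * Real.exp (-(1 / y)) := by gcongr; exact Real.add_one_le_exp _
  calc (#(Fintype.piFinset fun _ : Fin l => Uᶜ) : ℝ) = (#Uᶜ : ℝ) ^ l := by simp
    _ ≤ (Fintype.card ι * Real.exp (-(1 / y))) ^ l := by gcongr
    _ = Fintype.card ι ^ l * Real.exp (-(l / y)) := by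
      rw [mul_pow, ← Real.exp_nat_mul]
      ring_nf

theorem exists_tuple_hitting (hy : 0 < y) {s : Finset κ} {U : κ → Finset ι}
    (hU : ∀ q ∈ s, (Fintype.card ι : ℝ) ≤ y * #(U q)) (hs : #s * Real.exp (-(l / y)) < 1) :
    ∃ f : Fin l → ι, ∀ q ∈ s, ∃ x, f x ∈ U q := by
  classical
  by_contra! hcon
  have hcover : (univ : Finset (Fin l → ι)) ⊆
      s.biUnion fun q => Fintype.piFinset fun _ => (U q)ᶜ := fun f _ => by
    simpa using hcon f
  have hle : (Fintype.card ι : ℝ) ^ l ≤ Fintype.card ι ^ l * (#s * Real.exp (-(l / y))) := calc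
    (Fintype.card ι : ℝ) ^ l = #(univ : Finset (Fin l → ι)) := by simp
    _ ≤ ∑ q ∈ s, (#(Fintype.piFinset fun _ : Fin l => (U q)ᶜ) : ℝ) := by
      exact_mod_cast (card_le_card hcover).trans card_biUnion_le
    _ ≤ #s • (Fintype.card ι ^ l * Real.exp (-(l / y))) :=
      sum_le_card_nsmul _ _ _ fun q hq => card_piFinset_compl_le hy (hU q hq)
    _ = _ := by rw [nsmul_eq_mul]; ring
  have hpos : (0 : ℝ) < Fintype.card ι ^ l := by positivity
  nlinarith

theorem exists_injOn_trace [DecidableEq ι] (hy : 0 < y) {B : Finset (Finset ι)}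
    (hB : (B : Set (Finset ι)).Pairwise fun S T => (Fintype.card ι : ℝ) ≤ y * #(S ∆ T))
    (hl : 2 * y * Real.log #B < l) :
    ∃ f : Fin l → ι, Set.InjOn (fun T : Finset ι => trace f (T : Set ι)) B := by
  have hpairs : #B.offDiag * Real.exp (-(l / y)) < 1 := by
    rcases B.eq_empty_or_nonempty with rfl | hne
    · simp
    have hB0 : (0 : ℝ) < #B := by exact_mod_cast hne.card_pos
    calc #B.offDiag * Real.exp (-(l / y)) ≤ (#B : ℝ) ^ 2 * Real.exp (-(l / y)) := by
          gcongr
          rw [offDiag_card, sq]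
          exact_mod_cast Nat.sub_le _ _
      _ = Real.exp (2 * Real.log #B - l / y) := by
          rw [sub_eq_add_neg, Real.exp_add, ← Real.log_rpow hB0, Real.exp_log (by positivity),
            Real.rpow_two]
      _ < 1 := by
          rw [Real.exp_lt_one_iff, sub_neg, lt_div_iff₀ hy]
          linarith
  obtain ⟨f, hf⟩ := exists_tuple_hitting hy (U := fun q : Finset ι × Finset ι => q.1 ∆ q.2)
    (fun q hq => hB (mem_offDiag.1 hq).1 (mem_offDiag.1 hq).2.1 (mem_offDiag.1 hq).2.2) hpairs
  refine ⟨f, fun S hS T hT hST => ?_⟩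
  by_contra hne
  obtain ⟨x, hx⟩ := hf (S, T) (mem_offDiag.2 ⟨hS, hT, hne⟩)
  have := Finset.ext_iff.1 hST x
  simp only [mem_symmDiff, mem_trace, mem_coe] at hx this
  tauto

variable {D : Γ → Set V} {z : ι → V} {d : ℕ}

theorem log_card_le_of_separated [DecidableEq ι] (hd : 1 ≤ d) (hD : VCdim (Set.range D) ≤ d)
    {B : Finset (Finset ι)} (hBz : B ⊆ traces D z) (hy : 1 ≤ y)
    (hB : (B : Set (Finset ι)).Pairwise fun S T => (Fintype.card ι : ℝ) ≤ y * #(S ∆ T)) :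
    Real.log #B ≤ 2 * d * Real.log (3 * Real.exp 1 * y) := by
  have hd1 : (1 : ℝ) ≤ d := by exact_mod_cast hd
  have hlog : 1 ≤ Real.log (3 * Real.exp 1 * y) := by
    rw [Real.le_log_iff_exp_le (by positivity)]
    nlinarith [Real.exp_pos 1]
  rcases le_or_gt (Real.log #B) d with hsmall | hlarge
  · nlinarith
  have hne : B.Nonempty := by
    by_contra h
    rw [not_nonempty_iff_eq_empty.1 h, card_empty, Nat.cast_zero, Real.log_zero] at hlarge
    linarith
  -- `l` random points separate all pairs of members of `B` with positive probability, and Sauer's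
  -- bound for the traces on these points then bounds `#B` in terms of `log #B`.
  set L := Real.log #B
  set l := ⌊2 * y * L⌋₊ + 1 with hl
  have hl_gt : 2 * y * L < l := by rw [hl]; push_cast; exact Nat.lt_floor_add_one _
  have hl_le : (l : ℝ) ≤ 3 * y * L := by
    have : (⌊2 * y * L⌋₊ : ℝ) ≤ 2 * y * L := Nat.floor_le (by positivity)
    rw [hl]; push_cast
    nlinarith
  obtain ⟨f, hf⟩ := exists_injOn_trace (by linarith) hB hl_gt
  have hdl : d ≤ l := by
    have : (d : ℝ) ≤ l := by nlinarith
    exact_mod_cast this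
  have hL : L ≤ d * Real.log (3 * Real.exp 1 * y * (L / d)) := by
    refine (log_card_le_mul_log_of_injOn_trace hd hD hne hBz hdl hf).trans ?_
    have : (0 : ℝ) < l := by rw [hl]; positivity
    gcongr
    calc Real.exp 1 * l / d ≤ Real.exp 1 * (3 * y * L) / d := by gcongr
      _ = 3 * Real.exp 1 * y * (L / d) := by ring
  have := le_two_mul_log_of_le_log_mul (c := 3 * Real.exp 1 * y) (x := L / d) (by positivity)
    (div_pos (by linarith) (by linarith)) (by rwa [div_le_iff₀' (by linarith)])
  rw [div_le_iff₀ (by linarith)] at this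
  linarith

end Packing

section Rademacher

variable {ι κ : Type*} [Fintype ι] [DecidableEq ι]

theorem expect_exp_sum_sign_mul (a : ι → ℝ) :
    𝔼 σ : ι → ℤˣ, Real.exp (∑ i, (σ i : ℤ) * a i) = ∏ i, Real.cosh (a i) := by
  have hcosh (x : ℝ) : Real.cosh x = (∑ s : ℤˣ, Real.exp ((s : ℤ) * x)) / 2 := by
    rw [Real.cosh_eq, UnitsInt.univ, sum_pair (by decide)]
    simp
  simp_rw [Real.exp_sum, hcosh]
  rw [prod_div_distrib, Fintype.expect_eq_sum_div_card, prod_univ_sum]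
  simp [-UnitsInt.univ]

theorem expect_exp_sum_sign_mul_le (a : ι → ℝ) :
    𝔼 σ : ι → ℤˣ, Real.exp (∑ i, (σ i : ℤ) * a i) ≤ Real.exp ((∑ i, a i ^ 2) / 2) := by
  rw [expect_exp_sum_sign_mul, sum_div, Real.exp_sum]
  exact prod_le_prod (fun i _ => (Real.cosh_pos _).le) fun i _ => Real.cosh_le_exp_half_sq _

theorem exp_expect_le {Ω : Type*} [Fintype Ω] [Nonempty Ω] (f : Ω → ℝ) :
    Real.exp (𝔼 ω, f ω) ≤ 𝔼 ω, Real.exp (f ω) := by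
  have := convexOn_exp.map_sum_le (t := univ) (w := fun _ : Ω => (Fintype.card Ω : ℝ)⁻¹) (p := f)
    (fun _ _ => by positivity) (by simp) fun _ _ => Set.mem_univ _
  simpa [Fintype.expect_eq_sum_div_card, ← mul_sum, div_eq_inv_mul] using this

variable {I : Finset κ} {a : κ → ι → ℝ} {v : ℝ} {q : (ι → ℤˣ) → κ}

theorem exp_mul_expect_abs_sum_sign_mul_le (ha : ∀ k ∈ I, ∑ i, a k i ^ 2 ≤ v)
    (hq : ∀ σ, q σ ∈ I) (t : ℝ) :
    Real.exp (t * 𝔼 σ, |∑ i, (σ i : ℤ) * a (q σ) i|) ≤ 2 * #I * Real.exp (t ^ 2 * v / 2) := by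
  have hexp (k : κ) (hk : k ∈ I) (s : ℝ) (hs : s ^ 2 = t ^ 2) :
      𝔼 σ : ι → ℤˣ, Real.exp (s * ∑ i, (σ i : ℤ) * a k i) ≤ Real.exp (t ^ 2 * v / 2) := by
    simp_rw [mul_sum, mul_left_comm s]
    refine (expect_exp_sum_sign_mul_le _).trans ?_
    simp_rw [mul_pow, hs, ← mul_sum]
    gcongr
    exact ha k hk
  calc Real.exp (t * 𝔼 σ, |∑ i, (σ i : ℤ) * a (q σ) i|)
      ≤ 𝔼 σ, Real.exp (t * |∑ i, (σ i : ℤ) * a (q σ) i|) := by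
        rw [mul_expect]
        exact exp_expect_le _
    _ ≤ 𝔼 σ : ι → ℤˣ, ∑ k ∈ I, (Real.exp (t * ∑ i, (σ i : ℤ) * a k i) +
          Real.exp (-t * ∑ i, (σ i : ℤ) * a k i)) := by
        refine expect_le_expect fun σ _ => le_trans ?_ (single_le_sum
          (f := fun k => Real.exp (t * ∑ i, (σ i : ℤ) * a k i) +
            Real.exp (-t * ∑ i, (σ i : ℤ) * a k i)) (fun _ _ => by positivity) (hq σ))
        rcases abs_choice (∑ i, (σ i : ℤ) * a (q σ) i) with h | h <;> rw [h]
        · linarith [Real.exp_pos (-t * ∑ i, (σ i : ℤ) * a (q σ) i)]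
        · rw [mul_neg, ← neg_mul]
          linarith [Real.exp_pos (t * ∑ i, (σ i : ℤ) * a (q σ) i)]
    _ ≤ ∑ k ∈ I, (Real.exp (t ^ 2 * v / 2) + Real.exp (t ^ 2 * v / 2)) := by
        rw [expect_sum_comm]
        refine sum_le_sum fun k hk => ?_
        rw [expect_add_distrib]
        exact add_le_add (hexp k hk t rfl) (hexp k hk (-t) (neg_sq t))
    _ = 2 * #I * Real.exp (t ^ 2 * v / 2) := by
        rw [sum_const, nsmul_eq_mul]
        ring

theorem expect_abs_sum_sign_mul_le_sqrt (ha : ∀ k ∈ I, ∑ i, a k i ^ 2 ≤ v)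
    (hq : ∀ σ, q σ ∈ I) :
    𝔼 σ, |∑ i, (σ i : ℤ) * a (q σ) i| ≤ √(2 * v * Real.log (2 * #I)) := by
  have hI : (0 : ℝ) < #I := by exact_mod_cast card_pos.2 ⟨_, hq 1⟩
  set E := 𝔼 σ, |∑ i, (σ i : ℤ) * a (q σ) i|
  have hquad (t : ℝ) : 0 ≤ v / 2 * (t * t) + -E * t + Real.log (2 * #I) := by
    have := Real.log_le_log (Real.exp_pos _) (exp_mul_expect_abs_sum_sign_mul_le ha hq t)
    rw [Real.log_mul (by positivity) (Real.exp_pos _).ne', Real.log_exp, Real.log_exp] at this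
    linarith
  have hdiscrim := discrim_le_zero hquad
  rw [discrim] at hdiscrim
  exact Real.le_sqrt_of_sq_le (by linarith)

/-- The Rademacher sum `∑ i ∈ T, σ i` over an index set `T`. -/
def signedCard (σ : ι → ℤˣ) (T : Finset ι) : ℝ :=
  ∑ i ∈ T, ((σ i : ℤ) : ℝ)

theorem signedCard_sub (σ : ι → ℤˣ) (S T : Finset ι) :
    signedCard σ S - signedCard σ T =
      ∑ i, (σ i : ℤ) * ((if i ∈ S then 1 else 0) - (if i ∈ T then 1 else 0) : ℝ) := by
  simp [signedCard, mul_sub]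

theorem sum_sq_indicator_sub (S T : Finset ι) :
    ∑ i, ((if i ∈ S then 1 else 0) - (if i ∈ T then 1 else 0) : ℝ) ^ 2 = #(S ∆ T) := by
  have hsq (i : ι) : ((if i ∈ S then 1 else 0) - (if i ∈ T then 1 else 0) : ℝ) ^ 2 =
      if i ∈ S ∆ T then 1 else 0 := by
    by_cases hS : i ∈ S <;> by_cases hT : i ∈ T <;> simp [mem_symmDiff, hS, hT]
  simp [hsq]

end Rademacher

section RademacherSup

variable {ι V Γ : Type*} [Fintype ι]

/-- The Rademacher supremum `sup_a |∑ σ i|`, the sum running over the `i` with `z i ∈ D a`. -/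
noncomputable def rademacherSup (D : Γ → Set V) (z : ι → V) (σ : ι → ℤˣ) : ℝ :=
  ⨆ a, |signedCard σ (trace z (D a))|

theorem abs_signedCard_le_rademacherSup (D : Γ → Set V) (z : ι → V) (σ : ι → ℤˣ) (a : Γ) :
    |signedCard σ (trace z (D a))| ≤ rademacherSup D z σ := by
  classical
  exact le_ciSup (f := fun a => |signedCard σ (trace z (D a))|)
    ((Set.finite_range fun T => |signedCard σ T|).bddAbove.mono <|
      Set.range_comp_subset_range (fun a => trace z (D a)) fun T => |signedCard σ T|) a

end RademacherSup

section Chaining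

variable {ι : Type*} [DecidableEq ι]

theorem card_symmDiff_triangle (S T U : Finset ι) : #(S ∆ U) ≤ #(S ∆ T) + #(T ∆ U) :=
  (card_le_card (symmDiff_triangle S T U)).trans (card_union_le _ _)

variable [Fintype ι]

theorem expect_abs_signedCard_sub_le_sqrt {I : Finset (Finset ι × Finset ι)} {v : ℝ}
    (hI : ∀ P ∈ I, #(P.1 ∆ P.2) ≤ v) {q : (ι → ℤˣ) → Finset ι × Finset ι} (hq : ∀ σ, q σ ∈ I) :
    𝔼 σ, |signedCard σ (q σ).1 - signedCard σ (q σ).2| ≤ √(2 * v * Real.log (2 * #I)) := by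
  let a (P : Finset ι × Finset ι) (i : ι) : ℝ :=
    (if i ∈ P.1 then 1 else 0) - (if i ∈ P.2 then 1 else 0)
  have ha : ∀ P ∈ I, ∑ i, a P i ^ 2 ≤ v := fun P hP =>
    (sum_sq_indicator_sub P.1 P.2).trans_le (hI P hP)
  have hsub (σ) : signedCard σ (q σ).1 - signedCard σ (q σ).2 = ∑ i, (σ i : ℤ) * a (q σ) i :=
    signedCard_sub _ _ _
  simp only [hsub]
  exact expect_abs_sum_sign_mul_le_sqrt ha hq

theorem log_two_mul_card_image_pair_le {α β γ : Type*} [DecidableEq β] [DecidableEq γ]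
    {A : Finset α} (hA : A.Nonempty) (f : α → β) (g : α → γ) :
    Real.log (2 * #(A.image fun a => (f a, g a))) ≤
      1 + Real.log #(A.image f) + Real.log #(A.image g) := by
  have hf : (#(A.image f) : ℝ) ≠ 0 := by exact_mod_cast (hA.image f).card_pos.ne'
  have hg : (#(A.image g) : ℝ) ≠ 0 := by exact_mod_cast (hA.image g).card_pos.ne'
  have hpair : (#(A.image fun a => (f a, g a)) : ℝ) ≠ 0 := by
    exact_mod_cast (hA.image _).card_pos.ne'
  have hcard : #(A.image fun a => (f a, g a)) ≤ #(A.image f) * #(A.image g) := by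
    rw [← card_product]
    exact card_le_card <| image_subset_iff.2 fun a ha =>
      mem_product.2 ⟨mem_image_of_mem f ha, mem_image_of_mem g ha⟩
  have hlog : Real.log #(A.image fun a => (f a, g a)) ≤
      Real.log (#(A.image f) * #(A.image g)) :=
    Real.log_le_log (by positivity) (by exact_mod_cast hcard)
  rw [Real.log_mul hf hg] at hlog
  rw [Real.log_mul two_ne_zero hpair]
  linarith [Real.log_two_lt_d9]

theorem expect_abs_signedCard_sub_le {𝒯 : Finset (Finset ι)} {π π' : Finset ι → Finset ι}
    {r r' : ℝ} (hπ : ∀ T ∈ 𝒯, #(π T ∆ T) ≤ r) (hπ' : ∀ T ∈ 𝒯, #(π' T ∆ T) ≤ r')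
    {U : (ι → ℤˣ) → Finset ι} (hU : ∀ σ, U σ ∈ 𝒯) :
    𝔼 σ, |signedCard σ (π (U σ)) - signedCard σ (π' (U σ))| ≤
      √(2 * (r + r') * (1 + Real.log #(𝒯.image π) + Real.log #(𝒯.image π'))) := by
  have hpair (T) (hT : T ∈ 𝒯) : #(π T ∆ π' T) ≤ r + r' := calc
    (#(π T ∆ π' T) : ℝ) ≤ #(π T ∆ T) + #(T ∆ π' T) := by
      exact_mod_cast card_symmDiff_triangle _ _ _
    _ ≤ r + r' := add_le_add (hπ T hT) (symmDiff_comm T _ ▸ hπ' T hT)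
  have hr : 0 ≤ r + r' := (Nat.cast_nonneg _).trans (hpair _ (hU 1))
  refine (expect_abs_signedCard_sub_le_sqrt (I := 𝒯.image fun T => (π T, π' T)) (v := r + r')
    (q := fun σ => (π (U σ), π' (U σ))) (by simpa using hpair)
    fun σ => mem_image_of_mem _ (hU σ)).trans (Real.sqrt_le_sqrt ?_)
  exact mul_le_mul_of_nonneg_left (log_two_mul_card_image_pair_le ⟨_, hU 1⟩ π π') (by positivity)

theorem log_three_mul_exp_one_mul_four_pow_le (j : ℕ) :
    Real.log (3 * Real.exp 1 * 4 ^ j) ≤ 3 * (j + 1) := by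
  have hlog4 : Real.log 4 ≤ 2 := by
    rw [show (4 : ℝ) = 2 ^ 2 by norm_num, Real.log_pow]
    push_cast
    linarith [Real.log_two_lt_d9]
  have hlog3 : Real.log 3 ≤ 2 := by linarith [Real.log_le_sub_one_of_pos (x := 3) (by norm_num)]
  rw [Real.log_mul (by positivity) (by positivity), Real.log_mul (by norm_num) (by positivity),
    Real.log_exp, Real.log_pow]
  nlinarith [(j.cast_nonneg : (0 : ℝ) ≤ j)]

theorem sum_range_add_one_div_two_pow_le (J : ℕ) :
    ∑ j ∈ range J, ((j : ℝ) + 1) / 2 ^ j ≤ 4 := by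
  suffices h : ∑ j ∈ range J, ((j : ℝ) + 1) / 2 ^ j = 4 - (2 * J + 4) / 2 ^ J by
    rw [h, sub_le_self_iff]
    positivity
  induction J with
  | zero => norm_num
  | succ J ih =>
    rw [sum_range_succ, ih, pow_succ]
    field_simp
    push_cast
    ring

theorem chain_link_sq_le (d n j : ℕ) :
    2 * (4 * n / 4 ^ (j + 1) + 4 * n / 4 ^ j) * (d * (12 * j + 7)) ≤
      (9 * √(d * n) * (((j : ℝ) + 1) / 2 ^ j)) ^ 2 := by
  have hsq : (9 * √(d * n) * (((j : ℝ) + 1) / 2 ^ j)) ^ 2 =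
      d * n * (9 * (j + 1)) ^ 2 / 4 ^ j := by
    rw [mul_pow, mul_pow, Real.sq_sqrt (by positivity), div_pow, ← pow_mul, mul_comm j 2, pow_mul]
    norm_num
    ring
  calc 2 * (4 * n / 4 ^ (j + 1) + 4 * n / 4 ^ j) * (d * (12 * j + 7))
      = d * n * (120 * j + 70 : ℝ) / 4 ^ j := by
        rw [pow_succ]
        field_simp
        ring
    _ ≤ d * n * (9 * (j + 1) : ℝ) ^ 2 / 4 ^ j := by
        gcongr
        nlinarith [(j.cast_nonneg : (0 : ℝ) ≤ j)]
    _ = (9 * √(d * n) * (((j : ℝ) + 1) / 2 ^ j)) ^ 2 := hsq.symm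

variable [Nonempty ι] {V Γ : Type*} {D : Γ → Set V} {d : ℕ}

theorem exists_projection_traces (hd : 1 ≤ d) (hD : VCdim (Set.range D) ≤ d) (z : ι → V) (j : ℕ) :
    ∃ π : Finset ι → Finset ι,
      (∀ T ∈ traces D z, (#(π T ∆ T) : ℝ) ≤ Fintype.card ι / 4 ^ j) ∧
      Real.log #((traces D z).image π) ≤ 6 * d * (j + 1) := by
  obtain ⟨B, hBz, hB, hnet⟩ := exists_subset_pairwise_forall_exists_not
    (r := fun S T : Finset ι => (Fintype.card ι : ℝ) ≤ 4 ^ j * #(S ∆ T))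
    (fun S T h => symmDiff_comm S T ▸ h) (fun T => by simp) (traces D z)
  choose! π hπB hπ using hnet
  refine ⟨π, fun T hT => ?_, ?_⟩
  · rw [le_div_iff₀' (by positivity)]
    exact (not_le.1 (hπ T hT)).le
  rcases (traces D z).eq_empty_or_nonempty with hempty | hne
  · simp only [hempty, image_empty, card_empty, Nat.cast_zero, Real.log_zero]
    positivity
  calc Real.log #((traces D z).image π) ≤ Real.log #B := by
        refine Real.log_le_log (by exact_mod_cast (hne.image π).card_pos) ?_
        exact_mod_cast card_le_card (image_subset_iff.2 hπB)
    _ ≤ 2 * d * Real.log (3 * Real.exp 1 * 4 ^ j) :=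
        log_card_le_of_separated hd hD hBz (one_le_pow₀ (by norm_num)) hB
    _ ≤ 2 * d * (3 * (j + 1)) := by gcongr; exact log_three_mul_exp_one_mul_four_pow_le j
    _ = 6 * d * (j + 1) := by ring

theorem exists_chain_traces (hd : 1 ≤ d) (hD : VCdim (Set.range D) ≤ d) (z : ι → V) :
    ∃ π : ℕ → Finset ι → Finset ι, (∀ T, π 0 T = ∅) ∧
      (∀ j, ∀ T ∈ traces D z, (#(π j T ∆ T) : ℝ) ≤ 4 * Fintype.card ι / 4 ^ j) ∧
      ∀ j, Real.log #((traces D z).image (π j)) ≤ 6 * d * j := by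
  choose π hπ hlog using exists_projection_traces hd hD z
  refine ⟨fun j => j.casesOn (fun _ => ∅) π, fun _ => rfl, ?_, ?_⟩ <;> rintro (_ | j)
  · intro T _
    have : (#T : ℝ) ≤ Fintype.card ι := by exact_mod_cast card_le_univ T
    change (#(∅ ∆ T) : ℝ) ≤ _
    rw [← bot_eq_empty, bot_symmDiff, pow_zero, div_one]
    linarith [(Fintype.card ι).cast_nonneg (α := ℝ)]
  · intro T hT
    refine (hπ j T hT).trans_eq ?_
    rw [pow_succ]
    field_simp
  · simp only [Nat.cast_zero, mul_zero]
    refine Real.log_nonpos (by positivity) ?_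
    exact_mod_cast card_le_one.2 (by simp)
  · simpa using hlog j

theorem expect_abs_signedCard_le (hd : 1 ≤ d) (hD : VCdim (Set.range D) ≤ d) {z : ι → V}
    {U : (ι → ℤˣ) → Finset ι} (hU : ∀ σ, U σ ∈ traces D z) :
    𝔼 σ, |signedCard σ (U σ)| ≤ 36 * √(d * Fintype.card ι) := by
  have hd1 : (1 : ℝ) ≤ d := by exact_mod_cast hd
  obtain ⟨π, hπ₀, hπ, hlog⟩ := exists_chain_traces hd hD z
  obtain ⟨J, hJ⟩ := pow_unbounded_of_one_lt (4 * (Fintype.card ι : ℝ)) (by norm_num : (1 : ℝ) < 4)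
  have hπJ (T) (hT : T ∈ traces D z) : π J T = T := by
    have hlt : (#(π J T ∆ T) : ℝ) < 1 :=
      (hπ J T hT).trans_lt ((div_lt_one (by positivity)).2 hJ)
    have hzero : #(π J T ∆ T) = 0 := by exact_mod_cast Nat.lt_one_iff.1 (by exact_mod_cast hlt)
    exact symmDiff_eq_bot.1 (card_eq_zero.1 hzero)
  have htelescope (σ : ι → ℤˣ) : |signedCard σ (U σ)| ≤
      ∑ j ∈ range J, |signedCard σ (π (j + 1) (U σ)) - signedCard σ (π j (U σ))| := by
    refine le_trans (le_of_eq ?_) (abs_sum_le_sum_abs _ _)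
    rw [sum_range_sub (fun j => signedCard σ (π j (U σ))), hπJ _ (hU σ), hπ₀]
    simp [signedCard]
  have hlink (j : ℕ) : 𝔼 σ, |signedCard σ (π (j + 1) (U σ)) - signedCard σ (π j (U σ))| ≤
      9 * √(d * Fintype.card ι) * ((j + 1) / 2 ^ j) := by
    refine (expect_abs_signedCard_sub_le (hπ (j + 1)) (hπ j) hU).trans
      (Real.sqrt_le_iff.2 ⟨by positivity, ?_⟩)
    have hlogs : 1 + Real.log #((traces D z).image (π (j + 1))) +
        Real.log #((traces D z).image (π j)) ≤ d * (12 * j + 7) := by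
      have := hlog (j + 1)
      push_cast at this
      linarith [hlog j]
    refine le_trans ?_ (chain_link_sq_le d (Fintype.card ι) j)
    gcongr
  calc 𝔼 σ, |signedCard σ (U σ)| ≤ 𝔼 σ : ι → ℤˣ, ∑ j ∈ range J, _ :=
        expect_le_expect fun σ _ => htelescope σ
    _ = ∑ j ∈ range J, 𝔼 σ, |signedCard σ (π (j + 1) (U σ)) - signedCard σ (π j (U σ))| :=
        expect_sum_comm _ _ _
    _ ≤ ∑ j ∈ range J, 9 * √(d * Fintype.card ι) * (((j : ℝ) + 1) / 2 ^ j) :=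
        sum_le_sum fun j _ => hlink j
    _ ≤ 9 * √(d * Fintype.card ι) * 4 := by
        rw [← mul_sum]
        gcongr
        exact sum_range_add_one_div_two_pow_le J
    _ = 36 * √(d * Fintype.card ι) := by ring

theorem expect_rademacherSup_le (hd : 1 ≤ d) (hD : VCdim (Set.range D) ≤ d) (z : ι → V) :
    𝔼 σ, rademacherSup D z σ ≤ 36 * √(d * Fintype.card ι) := by
  cases isEmpty_or_nonempty Γ
  · simp only [rademacherSup, Real.iSup_of_isEmpty, expect_const_zero]
    positivity
  have hne : (traces D z).Nonempty := ⟨trace z (D (Classical.arbitrary Γ)), by simp⟩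
  choose U hU hmax using fun σ : ι → ℤˣ =>
    exists_max_image (traces D z) (fun T => |signedCard σ T|) hne
  refine le_trans (expect_le_expect fun σ _ => ?_) (expect_abs_signedCard_le hd hD hU)
  exact ciSup_le fun a => hmax σ _ (mem_traces.2 ⟨a, rfl⟩)

end Chaining

section Integrals

variable {α Γ : Type*} [MeasurableSpace α] {μ : Measure α} {C c : ℝ}

theorem integrable_of_forall_abs_le [DiscreteMeasurableSpace α] [IsFiniteMeasure μ] {f : α → ℝ}
    (h : ∀ x, |f x| ≤ C) : Integrable f μ :=
  .of_bound Measurable.of_discrete.aestronglyMeasurable C (.of_forall h)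

theorem integral_le_of_forall_le [IsProbabilityMeasure μ] {f : α → ℝ} (hf : Integrable f μ)
    (h : ∀ x, f x ≤ C) : ∫ x, f x ∂μ ≤ C :=
  (integral_mono hf (integrable_const C) h).trans_eq (by simp)

theorem le_iSup_abs {φ : Γ → ℝ} (h : ∀ a, |φ a| ≤ C) (a : Γ) : |φ a| ≤ ⨆ a, |φ a| :=
  le_ciSup (f := fun a => |φ a|) ⟨C, Set.forall_mem_range.2 h⟩ a

theorem abs_iSup_abs_le (hC : 0 ≤ C) {φ : Γ → ℝ} (h : ∀ a, |φ a| ≤ C) : |(⨆ a, |φ a|)| ≤ C := by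
  rw [abs_of_nonneg (Real.iSup_nonneg fun _ => abs_nonneg _)]
  exact Real.iSup_le h hC

theorem iSup_abs_le_iSup_abs_add (hc : 0 ≤ c) {φ ψ : Γ → ℝ} (hψ : ∀ a, |ψ a| ≤ C)
    (h : ∀ a, |φ a - ψ a| ≤ c) : (⨆ a, |φ a|) ≤ (⨆ a, |ψ a|) + c := by
  refine Real.iSup_le (fun a => ?_) (add_nonneg (Real.iSup_nonneg fun _ => abs_nonneg _) hc)
  linarith [le_iSup_abs hψ a, h a, abs_sub_abs_le_abs_sub (φ a) (ψ a)]

theorem abs_integral_le_integral_iSup_abs [DiscreteMeasurableSpace α] [IsFiniteMeasure μ]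
    (hC : 0 ≤ C) {φ : Γ → α → ℝ} (h : ∀ a x, |φ a x| ≤ C) (a : Γ) :
    |∫ x, φ a x ∂μ| ≤ ∫ x, ⨆ a, |φ a x| ∂μ :=
  abs_integral_le_integral_abs.trans <|
    integral_mono (integrable_of_forall_abs_le (h a)).abs
      (integrable_of_forall_abs_le fun x => abs_iSup_abs_le hC (h · x)) fun x =>
        le_iSup_abs (h · x) a

end Integrals

section Frequencies

variable {V ι Γ : Type*} [Fintype ι]

/-- The fraction of the sample points `z i` that lie in `A`. -/
noncomputable def freq (z : ι → V) (A : Set V) : ℝ := #(trace z A) / Fintype.card ι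

theorem freq_mem_Icc (z : ι → V) (A : Set V) : freq z A ∈ Set.Icc (0 : ℝ) 1 :=
  ⟨by unfold freq; positivity,
    div_le_one_of_le₀ (by exact_mod_cast card_le_univ _) (Nat.cast_nonneg _)⟩

theorem freq_eq_sum_div (z : ι → V) (A : Set V) :
    freq z A = (∑ i, A.indicator 1 (z i)) / Fintype.card ι := by
  classical
  simp only [freq, trace, Set.indicator_apply, Pi.one_apply, sum_boole]

theorem abs_freq_sub_freq_le {z w : ι → V} {I : Finset ι} (h : ∀ i ∉ I, z i = w i) (A : Set V) :
    |freq z A - freq w A| ≤ #I / Fintype.card ι := by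
  rw [freq_eq_sum_div, freq_eq_sum_div, ← sub_div, ← sum_sub_distrib, abs_div, Nat.abs_cast,
    ← sum_subset (subset_univ I) fun i _ hi => by rw [h i hi, sub_self]]
  gcongr
  refine (abs_sum_le_sum_abs _ _).trans ((sum_le_card_nsmul I _ 1 fun i _ => ?_).trans_eq (by simp))
  by_cases hz : z i ∈ A <;> by_cases hw : w i ∈ A <;> simp [hz, hw]

/-- The largest difference, over the sets `D a`, between the frequencies in two samples. -/
noncomputable def ghostDev (D : Γ → Set V) (S S' : ι → V) : ℝ :=
  ⨆ a, |freq S' (D a) - freq S (D a)|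

theorem abs_freq_sub_freq_le_one (A : Set V) (S S' : ι → V) : |freq S' A - freq S A| ≤ 1 :=
  abs_sub_le_of_nonneg_of_le (freq_mem_Icc S' A).1 (freq_mem_Icc S' A).2
    (freq_mem_Icc S A).1 (freq_mem_Icc S A).2

theorem abs_ghostDev_le_one (D : Γ → Set V) (S S' : ι → V) : |ghostDev D S S'| ≤ 1 :=
  abs_iSup_abs_le zero_le_one fun a => abs_freq_sub_freq_le_one (D a) S S'

variable [DecidableEq ι]

theorem freq_piecewise_sub_freq_piecewise (S S' : ι → V) (σ : ι → ℤˣ) (A : Set V) :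
    freq (({i | σ i = 1} : Finset ι).piecewise S' S) A -
        freq (({i | σ i = 1} : Finset ι).piecewise S S') A =
      (signedCard σ (trace S' A) - signedCard σ (trace S A)) / Fintype.card ι := by
  classical
  rw [freq_eq_sum_div, freq_eq_sum_div, ← sub_div, ← sum_sub_distrib, signedCard_sub]
  congr! 2 with i
  rcases Int.units_eq_one_or (σ i) with h | h <;>
    simp [Finset.piecewise, h, Set.indicator_apply]

theorem ghostDev_piecewise_le (D : Γ → Set V) (S S' : ι → V) (σ : ι → ℤˣ) :
    ghostDev D (({i | σ i = 1} : Finset ι).piecewise S S')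
        (({i | σ i = 1} : Finset ι).piecewise S' S) ≤
      (rademacherSup D S' σ + rademacherSup D S σ) / Fintype.card ι := by
  refine Real.iSup_le (fun a => ?_) ?_
  · rw [freq_piecewise_sub_freq_piecewise, abs_div, Nat.abs_cast]
    gcongr
    exact (abs_sub _ _).trans
      (add_le_add (abs_signedCard_le_rademacherSup D S' σ a)
        (abs_signedCard_le_rademacherSup D S σ a))
  · exact div_nonneg (add_nonneg (Real.iSup_nonneg fun _ => abs_nonneg _)
      (Real.iSup_nonneg fun _ => abs_nonneg _)) (Nat.cast_nonneg _)

theorem expect_ghostDev_piecewise_le [Nonempty ι] {d : ℕ} (hd : 1 ≤ d)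
    {D : Γ → Set V} (hD : VCdim (Set.range D) ≤ d) (S S' : ι → V) :
    𝔼 σ : ι → ℤˣ, ghostDev D (({i | σ i = 1} : Finset ι).piecewise S S')
      (({i | σ i = 1} : Finset ι).piecewise S' S) ≤ 72 * √(d / Fintype.card ι) := by
  have hsqrt : √(d * Fintype.card ι) / Fintype.card ι = √(d / Fintype.card ι) := by
    rw [Real.sqrt_mul (by positivity), Real.sqrt_div (by positivity), mul_div_assoc,
      Real.sqrt_div_self', mul_one_div]
  calc _ ≤ 𝔼 σ : ι → ℤˣ, (rademacherSup D S' σ + rademacherSup D S σ) / Fintype.card ι :=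
        expect_le_expect fun σ _ => ghostDev_piecewise_le D S S' σ
    _ = (𝔼 σ, rademacherSup D S' σ + 𝔼 σ, rademacherSup D S σ) / Fintype.card ι := by
        rw [← expect_div, expect_add_distrib]
    _ ≤ (36 * √(d * Fintype.card ι) + 36 * √(d * Fintype.card ι)) / Fintype.card ι := by
        gcongr <;> exact expect_rademacherSup_le hd hD _
    _ = 72 * √(d / Fintype.card ι) := by rw [← hsqrt]; ring

end Frequencies

section Swapping

variable {V ι : Type*} [MeasurableSpace V] [Fintype ι] [DecidableEq ι]

theorem measurePreserving_piecewise (μ : ι → Measure V) [∀ i, SigmaFinite (μ i)] (I : Finset ι) :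
    MeasurePreserving
      (fun q : (ι → V) × (ι → V) => (I.piecewise q.1 q.2, I.piecewise q.2 q.1))
      ((Measure.pi μ).prod (Measure.pi μ)) ((Measure.pi μ).prod (Measure.pi μ)) := by
  have hpairs := measurePreserving_arrowProdEquivProdArrow V V ι μ μ
  have hswap : MeasurePreserving (fun (Z : ι → V × V) i => if i ∈ I then Z i else (Z i).swap)
      (Measure.pi fun i => (μ i).prod (μ i)) (Measure.pi fun i => (μ i).prod (μ i)) := by
    refine measurePreserving_pi (f := fun i (x : V × V) => if i ∈ I then x else x.swap)
      _ _ fun i => ?_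
    by_cases hi : i ∈ I
    · simp only [hi, if_true]
      exact MeasurePreserving.id _
    · simpa only [hi, if_false] using Measure.measurePreserving_swap
  convert (hpairs.comp hswap).comp (hpairs.symm _) using 1
  funext q
  ext i <;> by_cases hi : i ∈ I <;>
    simp [hi, MeasurableEquiv.arrowProdEquivProdArrow, Equiv.arrowProdEquivProdArrow]

theorem integral_piecewise [Countable V] [MeasurableSingletonClass V] (μ : ι → Measure V)
    [∀ i, SigmaFinite (μ i)] (I : Finset ι) (F : (ι → V) → (ι → V) → ℝ) :
    ∫ q, F (I.piecewise q.1 q.2) (I.piecewise q.2 q.1) ∂(Measure.pi μ).prod (Measure.pi μ) =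
      ∫ q, F q.1 q.2 ∂(Measure.pi μ).prod (Measure.pi μ) := by
  have h := measurePreserving_piecewise μ I
  conv_rhs => rw [← h.map_eq]
  rw [integral_map h.measurable.aemeasurable Measurable.of_discrete.aestronglyMeasurable]

end Swapping

section Symmetrization

variable {V ι Γ : Type*} [MeasurableSpace V] [Fintype ι] (p : Measure V) [IsProbabilityMeasure p]

/-- The largest deviation, over the sets `D a`, of the frequency in the sample `z` from the
probability. -/
noncomputable def uniformDev (p : Measure V) (D : Γ → Set V) (z : ι → V) : ℝ :=
  ⨆ a, |p.real (D a) - freq z (D a)|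

theorem abs_measureReal_sub_freq_le_one (A : Set V) (z : ι → V) : |p.real A - freq z A| ≤ 1 :=
  abs_sub_le_of_nonneg_of_le measureReal_nonneg measureReal_le_one
    (freq_mem_Icc z A).1 (freq_mem_Icc z A).2

theorem abs_measureReal_sub_freq_le_uniformDev (D : Γ → Set V) (z : ι → V) (a : Γ) :
    |p.real (D a) - freq z (D a)| ≤ uniformDev p D z :=
  le_iSup_abs (fun a => abs_measureReal_sub_freq_le_one p (D a) z) a

theorem uniformDev_nonneg (p : Measure V) (D : Γ → Set V) (z : ι → V) : 0 ≤ uniformDev p D z :=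
  Real.iSup_nonneg fun _ => abs_nonneg _

theorem abs_uniformDev_le_one (D : Γ → Set V) (z : ι → V) : |uniformDev p D z| ≤ 1 :=
  abs_iSup_abs_le zero_le_one fun a => abs_measureReal_sub_freq_le_one p (D a) z

theorem uniformDev_le_uniformDev_add {z w : ι → V} {I : Finset ι} (h : ∀ i ∉ I, z i = w i)
    (D : Γ → Set V) : uniformDev p D z ≤ uniformDev p D w + #I / Fintype.card ι := by
  refine iSup_abs_le_iSup_abs_add (by positivity)
    (fun a => abs_measureReal_sub_freq_le_one p (D a) w) fun a => ?_
  rw [sub_sub_sub_cancel_left]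
  exact abs_freq_sub_freq_le (fun i hi => (h i hi).symm) (D a)

variable [Countable V] [MeasurableSingletonClass V]

theorem integral_freq [Nonempty ι] (A : Set V) :
    ∫ z, freq z A ∂(Measure.pi fun _ : ι => p) = p.real A := by
  have hcoord (i : ι) : ∫ z, A.indicator 1 (z i) ∂(Measure.pi fun _ : ι => p) = p.real A :=
    calc ∫ z, A.indicator 1 (z i) ∂(Measure.pi fun _ : ι => p)
        = ∫ v, A.indicator 1 v ∂(Measure.pi fun _ : ι => p).map (Function.eval i) :=
          (integral_map (measurable_pi_apply i).aemeasurable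
            Measurable.of_discrete.aestronglyMeasurable).symm
      _ = p.real A := by
          rw [(measurePreserving_eval (fun _ : ι => p) i).map_eq,
            integral_indicator_one .of_discrete]
  simp only [freq_eq_sum_div]
  rw [integral_div,
    integral_finsetSum _ fun i _ => integrable_of_forall_abs_le (C := 1) fun z => ?_]
  · simp [hcoord]
  · by_cases hz : z i ∈ A <;> simp [hz]

theorem uniformDev_le_integral_ghostDev [Nonempty ι] (D : Γ → Set V) (S : ι → V) :
    uniformDev p D S ≤ ∫ S', ghostDev D S S' ∂(Measure.pi fun _ : ι => p) := by
  have hterm (a : Γ) : p.real (D a) - freq S (D a) =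
      ∫ S', (freq S' (D a) - freq S (D a)) ∂(Measure.pi fun _ : ι => p) := by
    have hint : Integrable (fun S' => freq S' (D a)) (Measure.pi fun _ : ι => p) :=
      integrable_of_forall_abs_le fun S' =>
        (abs_of_nonneg (freq_mem_Icc S' (D a)).1).trans_le (freq_mem_Icc S' (D a)).2
    rw [integral_sub hint (integrable_const _), integral_freq]
    simp
  simp only [uniformDev, hterm]
  exact Real.iSup_le
    (abs_integral_le_integral_iSup_abs zero_le_one fun a S' => abs_freq_sub_freq_le_one (D a) S S')
    (integral_nonneg fun S' => Real.iSup_nonneg fun _ => abs_nonneg _)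

theorem integral_ghostDev_le [Nonempty ι] {d : ℕ} (hd : 1 ≤ d) {D : Γ → Set V}
    (hD : VCdim (Set.range D) ≤ d) :
    ∫ q, ghostDev D q.1 q.2 ∂(Measure.pi fun _ : ι => p).prod (Measure.pi fun _ : ι => p) ≤
      72 * √(d / Fintype.card ι) := by
  classical
  set P := Measure.pi fun _ : ι => p
  let I (σ : ι → ℤˣ) : Finset ι := {i | σ i = 1}
  have hint (σ : ι → ℤˣ) : Integrable (fun q : (ι → V) × (ι → V) =>
      ghostDev D ((I σ).piecewise q.1 q.2) ((I σ).piecewise q.2 q.1)) (P.prod P) :=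
    integrable_of_forall_abs_le fun q => abs_ghostDev_le_one D _ _
  calc ∫ q, ghostDev D q.1 q.2 ∂P.prod P
      = 𝔼 σ : ι → ℤˣ, ∫ q, ghostDev D ((I σ).piecewise q.1 q.2) ((I σ).piecewise q.2 q.1)
          ∂P.prod P := by
        simp only [P, integral_piecewise (fun _ => p) _ (ghostDev D), Fintype.expect_const]
    _ = ∫ q, 𝔼 σ : ι → ℤˣ, ghostDev D ((I σ).piecewise q.1 q.2) ((I σ).piecewise q.2 q.1)
          ∂P.prod P := by
        simp only [Fintype.expect_eq_sum_div_card]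
        rw [integral_div, integral_finsetSum _ fun σ _ => hint σ]
    _ ≤ 72 * √(d / Fintype.card ι) := by
        refine integral_le_of_forall_le ?_ fun q => expect_ghostDev_piecewise_le hd hD q.1 q.2
        simp only [Fintype.expect_eq_sum_div_card]
        exact (integrable_finsetSum _ fun σ _ => hint σ).div_const _

theorem integral_uniformDev_le [Nonempty ι] {d : ℕ} (hd : 1 ≤ d) {D : Γ → Set V}
    (hD : VCdim (Set.range D) ≤ d) :
    ∫ S, uniformDev p D S ∂(Measure.pi fun _ : ι => p) ≤ 72 * √(d / Fintype.card ι) := by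
  have hint : Integrable (fun q : (ι → V) × (ι → V) => ghostDev D q.1 q.2)
      ((Measure.pi fun _ : ι => p).prod (Measure.pi fun _ : ι => p)) :=
    integrable_of_forall_abs_le fun q => abs_ghostDev_le_one D q.1 q.2
  refine le_trans ?_ (integral_ghostDev_le p hd hD)
  rw [integral_prod _ hint]
  exact integral_mono (integrable_of_forall_abs_le (abs_uniformDev_le_one p D))
    hint.integral_prod_left (uniformDev_le_integral_ghostDev p D)

theorem integral_uniformDev_comp_le [Nonempty ι] {κ : Type*} [Fintype κ] {d : ℕ} (hd : 1 ≤ d)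
    {D : (κ → V) → Γ → Set V} (hD : ∀ u, VCdim (Set.range (D u)) ≤ d) (i : κ → ι) :
    ∫ S, uniformDev p (D (S ∘ i)) S ∂(Measure.pi fun _ : ι => p) ≤
      72 * √(d / Fintype.card ι) + Fintype.card κ / Fintype.card ι := by
  classical
  set P := Measure.pi fun _ : ι => p
  set I : Finset ι := univ.image i
  let F (S S' : ι → V) : ℝ := uniformDev p (D (S ∘ i)) S'
  have hint (f g : (ι → V) × (ι → V) → (ι → V)) : Integrable (fun q => F (f q) (g q)) (P.prod P) :=
    integrable_of_forall_abs_le fun q => abs_uniformDev_le_one p _ _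
  have hresample (S S' : ι → V) : F S S ≤
      F (I.piecewise S S') (I.piecewise S' S) + Fintype.card κ / Fintype.card ι := by
    have hcomp : I.piecewise S S' ∘ i = S ∘ i := by
      funext l
      simp [I, Finset.piecewise]
    simp only [F, hcomp]
    refine (uniformDev_le_uniformDev_add p (w := I.piecewise S' S)
      (I := I) (fun j hj => ?_) _).trans ?_
    · exact (I.piecewise_eq_of_notMem S' S hj).symm
    · gcongr
      exact card_image_le
  calc ∫ S, F S S ∂P = ∫ q, F q.1 q.1 ∂P.prod P := by
        rw [integral_fun_fst fun S => F S S]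
        simp
    _ ≤ ∫ q, (F (I.piecewise q.1 q.2) (I.piecewise q.2 q.1) +
          Fintype.card κ / Fintype.card ι) ∂P.prod P :=
        integral_mono (hint _ _) ((hint _ _).add (integrable_const _)) fun q => hresample q.1 q.2
    _ = ∫ q, F q.1 q.2 ∂P.prod P + Fintype.card κ / Fintype.card ι := by
        rw [integral_add (hint _ _) (integrable_const _), integral_piecewise (fun _ => p) I F]
        simp [P]
    _ ≤ 72 * √(d / Fintype.card ι) + Fintype.card κ / Fintype.card ι := by
        rw [integral_prod _ (hint Prod.fst Prod.snd)]
        gcongr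
        exact integral_le_of_forall_le (hint Prod.fst Prod.snd).integral_prod_left fun S =>
          integral_uniformDev_le p hd (hD (S ∘ i))

end Symmetrization

section BoundedDifferences

open ProbabilityTheory
open scoped NNReal

theorem exists_forall_mem_Icc_of_abs_sub_le {α : Type*} [Nonempty α] {g : α → ℝ} {c : ℝ}
    (hc : ∀ x y, |g x - g y| ≤ c) : ∃ a, ∀ x, g x ∈ Set.Icc a (a + c) := by
  have hbdd (x y : α) : g x - c ≤ g y := by linarith [(abs_le.1 (hc x y)).2]
  refine ⟨⨅ y, g y, fun x => ⟨ciInf_le ⟨g x - c, Set.forall_mem_range.2 (hbdd x)⟩ x, ?_⟩⟩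
  linarith [le_ciInf (hbdd x)]

variable {α β : Type*} [MeasurableSpace α] [MeasurableSpace β] {μ : Measure α} {ν : Measure β}

theorem hasSubgaussianMGF_fst_add [SFinite μ] [SFinite ν] {X : α → ℝ} {Y : α × β → ℝ} {c v : ℝ≥0}
    (hX : HasSubgaussianMGF X c μ) (hY : ∀ a, HasSubgaussianMGF (fun b => Y (a, b)) v ν)
    (hint : ∀ t, Integrable (fun q => Real.exp (t * (X q.1 + Y q))) (μ.prod ν)) :
    HasSubgaussianMGF (fun q => X q.1 + Y q) (c + v) (μ.prod ν) where
  integrable_exp_mul := hint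
  mgf_le t := by
    have hsplit (a : α) (b : β) : Real.exp (t * (X a + Y (a, b))) =
        Real.exp (t * X a) * Real.exp (t * Y (a, b)) := by rw [mul_add, Real.exp_add]
    calc mgf (fun q => X q.1 + Y q) (μ.prod ν) t
        = ∫ a, Real.exp (t * X a) * mgf (fun b => Y (a, b)) ν t ∂μ := by
          rw [mgf, integral_prod _ (hint t)]
          simp only [hsplit, integral_const_mul, mgf]
      _ ≤ ∫ a, Real.exp (t * X a) * Real.exp (v * t ^ 2 / 2) ∂μ := by
          refine integral_mono_of_nonneg
            (.of_forall fun a => mul_nonneg (Real.exp_pos _).le mgf_nonneg)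
            ((hX.integrable_exp_mul t).mul_const _) (.of_forall fun a => ?_)
          dsimp only
          gcongr
          exact (hY a).mgf_le t
      _ ≤ Real.exp (c * t ^ 2 / 2) * Real.exp (v * t ^ 2 / 2) := by
          rw [integral_mul_const]
          gcongr
          exact hX.mgf_le t
      _ = Real.exp ((c + v : ℝ≥0) * t ^ 2 / 2) := by
          rw [← Real.exp_add, NNReal.coe_add]
          ring_nf

variable [IsProbabilityMeasure μ] [IsProbabilityMeasure ν]

theorem hasSubgaussianMGF_sub_integral_of_abs_sub_le {g : α → ℝ} (hg : AEMeasurable g μ) {c : ℝ≥0}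
    (hc : ∀ x y, |g x - g y| ≤ c) :
    HasSubgaussianMGF (fun x => g x - ∫ y, g y ∂μ) ((c / 2) ^ 2) μ := by
  have := μ.nonempty_of_neZero
  obtain ⟨a, ha⟩ := exists_forall_mem_Icc_of_abs_sub_le hc
  simpa using hasSubgaussianMGF_of_mem_Icc hg (.of_forall ha)

theorem hasSubgaussianMGF_prod_sub_integral {F : α × β → ℝ} (hF : Measurable F) {C : ℝ}
    (hC : ∀ q q', |F q - F q'| ≤ C) {c v : ℝ≥0}
    (hfst : ∀ a a' b, |F (a, b) - F (a', b)| ≤ c)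
    (hsnd : ∀ a, HasSubgaussianMGF (fun b => F (a, b) - ∫ b, F (a, b) ∂ν) v ν) :
    HasSubgaussianMGF (fun q => F q - ∫ q, F q ∂μ.prod ν) ((c / 2) ^ 2 + v) (μ.prod ν) := by
  have := (μ.prod ν).nonempty_of_neZero
  obtain ⟨l, hl⟩ := exists_forall_mem_Icc_of_abs_sub_le hC
  have hint : Integrable F (μ.prod ν) := .of_mem_Icc l (l + C) hF.aemeasurable (.of_forall hl)
  have hsec (a : α) : Integrable (fun b => F (a, b)) ν :=
    .of_mem_Icc l (l + C) (hF.comp measurable_prodMk_left).aemeasurable (.of_forall fun b => hl _)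
  let g (a : α) : ℝ := ∫ b, F (a, b) ∂ν
  have hg : AEMeasurable g μ :=
    hF.stronglyMeasurable.integral_prod_right'.measurable.aemeasurable
  have hgc (a a' : α) : |g a - g a'| ≤ c := by
    rw [← integral_sub (hsec a) (hsec a')]
    exact abs_integral_le_integral_abs.trans
      (integral_le_of_forall_le ((hsec a).sub (hsec a')).abs (hfst a a'))
  have hgint : ∫ a, g a ∂μ = ∫ q, F q ∂μ.prod ν := (integral_prod F hint).symm
  have hsum := hasSubgaussianMGF_fst_add (Y := fun q => F q - g q.1)
    (hasSubgaussianMGF_sub_integral_of_abs_sub_le hg hgc) hsnd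
  simp only [hgint, sub_add_sub_cancel'] at hsum
  refine hsum fun t => ?_
  simp only [mul_sub, Real.exp_sub]
  exact (integrable_exp_mul_of_mem_Icc hF.aemeasurable (.of_forall hl)).div_const _

theorem abs_sub_le_sum_of_bounded_differences {ι : Type*} [Fintype ι] [DecidableEq ι]
    {X : ι → Type*} {f : (∀ i, X i) → ℝ} {c : ι → ℝ}
    (hf : ∀ x i y, |f x - f (Function.update x i y)| ≤ c i) (x y : ∀ i, X i) :
    |f x - f y| ≤ ∑ i, c i := by
  suffices h : ∀ s : Finset ι, |f x - f (s.piecewise y x)| ≤ ∑ i ∈ s, c i by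
    simpa using h univ
  intro s
  induction s using Finset.induction_on with
  | empty => simp
  | insert j s hj ih =>
    rw [piecewise_insert, sum_insert hj, add_comm]
    exact (abs_sub_le _ (f (s.piecewise y x)) _).trans (add_le_add ih (hf _ j _))

theorem hasSubgaussianMGF_of_bounded_differences {n : ℕ} {X : Fin n → Type*}
    [∀ i, MeasurableSpace (X i)] (μ : ∀ i, Measure (X i)) [∀ i, IsProbabilityMeasure (μ i)]
    {f : (∀ i, X i) → ℝ} (hf : Measurable f) {c : Fin n → ℝ≥0}
    (hc : ∀ x i y, |f x - f (Function.update x i y)| ≤ c i) :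
    HasSubgaussianMGF (fun x => f x - ∫ x, f x ∂Measure.pi μ) (∑ i, (c i / 2) ^ 2)
      (Measure.pi μ) := by
  induction n with
  | zero =>
    have hconst : f = fun _ => f default := funext fun x => by rw [Subsingleton.elim x default]
    rw [hconst]
    simp
  | succ n ih =>
    have he := measurePreserving_piFinSuccAbove μ 0
    let e := MeasurableEquiv.piFinSuccAbove X 0
    let F (q : X 0 × ∀ j, X (Fin.succAbove 0 j)) : ℝ := f (Fin.insertNth 0 q.1 q.2)
    have hFe (x) : F (e x) = f x := congr_arg f (e.symm_apply_apply x)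
    have hF : Measurable F := hf.comp e.symm.measurable
    have hprod := hasSubgaussianMGF_prod_sub_integral (μ := μ 0)
      (ν := Measure.pi fun j => μ (Fin.succAbove 0 j)) hF (C := ∑ i, (c i : ℝ))
      (fun q q' => abs_sub_le_sum_of_bounded_differences hc _ _) (c := c 0)
      (fun a a' b => by
        simpa only [F, Fin.update_insertNth] using hc (Fin.insertNth 0 a b) 0 a')
      (fun a => ih (fun j => μ (Fin.succAbove 0 j)) (hF.comp measurable_prodMk_left)
        (c := fun j => c (Fin.succAbove 0 j)) fun x j y => by
          simpa only [F, Function.comp_apply, Fin.insertNth_update] using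
            hc (Fin.insertNth 0 a x) (Fin.succAbove 0 j) y)
    have hmean : ∫ q, F q ∂(μ 0).prod (Measure.pi fun j => μ (Fin.succAbove 0 j)) =
        ∫ x, f x ∂Measure.pi μ := by
      rw [← he.integral_comp']
      exact integral_congr_ae (.of_forall hFe)
    rw [hmean, ← he.map_eq] at hprod
    have h := HasSubgaussianMGF.of_map e.measurable.aemeasurable hprod
    rw [Fin.sum_univ_succAbove _ 0]
    simpa only [Function.comp_def, hFe] using h

end BoundedDifferences

section EdgeFrequencies

variable {V Γ : Type*} {k m : ℕ}

theorem empFreq_eq_freq (S : Fin m → V) (g : Set (Fin k → V)) :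
    empFreq S g = freq (fun i : Fin k → Fin m => S ∘ i) g := by
  simp only [freq_eq_sum_div, Fintype.card_fun, Fintype.card_fin, Nat.cast_pow]
  rfl

theorem empFreq_mem_Icc (S : Fin m → V) (g : Set (Fin k → V)) : empFreq S g ∈ Set.Icc (0 : ℝ) 1 :=
  empFreq_eq_freq S g ▸ freq_mem_Icc _ g

theorem card_filter_exists_eq_le (j : Fin m) :
    (#{i : Fin k → Fin m | ∃ l, i l = j} : ℝ) ≤ k / m * (m : ℝ) ^ k := by
  have hm : (m : ℝ) ≠ 0 := Nat.cast_ne_zero.2 j.pos.ne'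
  have hcard (l : Fin k) : #{i : Fin k → Fin m | i l = j} = m ^ (k - 1) := by
    simpa using Fintype.card_filter_piFinset_const_eq_of_mem univ l (mem_univ j)
  have hunion : ({i : Fin k → Fin m | ∃ l, i l = j} : Finset _) =
      univ.biUnion fun l => {i : Fin k → Fin m | i l = j} := by
    ext i
    simp
  rcases k with _ | k
  · simp
  calc (#{i : Fin (k + 1) → Fin m | ∃ l, i l = j} : ℝ) ≤ ((k + 1 : ℕ) * m ^ k : ℕ) := by
        rw [hunion]
        exact_mod_cast card_biUnion_le.trans (by simp [hcard])
    _ = (k + 1 : ℕ) / m * (m : ℝ) ^ (k + 1) := by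
        rw [pow_succ]
        push_cast
        field_simp

theorem abs_empFreq_sub_update_le (S : Fin m → V) (j : Fin m) (x : V) (g : Set (Fin k → V)) :
    |empFreq S g - empFreq (Function.update S j x) g| ≤ k / m := by
  have hm : (0 : ℝ) < m := Nat.cast_pos.2 j.pos
  rw [empFreq_eq_freq, empFreq_eq_freq]
  refine (abs_freq_sub_freq_le (I := {i : Fin k → Fin m | ∃ l, i l = j})
    (fun i hi => ?_) g).trans ?_
  · simp only [mem_filter_univ, not_exists] at hi
    exact funext fun l => (Function.update_of_ne (hi l) ..).symm
  · rw [Fintype.card_fun, Fintype.card_fin, Fintype.card_fin, Nat.cast_pow,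
      div_le_iff₀ (by positivity)]
    exact card_filter_exists_eq_le j

/-- The set of vertices that complete the tail `u` to a hyperedge of `g`. -/
def fixTail (u : Fin k → V) (g : Set (Fin (k + 1) → V)) : Set V :=
  {x | (Fin.cons x u : Fin (k + 1) → V) ∈ g}

theorem empFreq_eq_sum_freq_fixTail (S : Fin m → V) (g : Set (Fin (k + 1) → V)) :
    empFreq S g = (∑ i : Fin k → Fin m, freq S (fixTail (S ∘ i) g)) / (m : ℝ) ^ k := by
  simp only [freq_eq_sum_div, Fintype.card_fin]
  rw [empFreq, ← sum_div, div_div, ← pow_succ', sum_comm]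
  congr 1
  rw [← (Fin.consEquiv fun _ => Fin m).sum_comp, Fintype.sum_prod_type]
  refine sum_congr rfl fun j _ => sum_congr rfl fun i _ => ?_
  have hcons : S ∘ (Fin.cons j i : Fin (k + 1) → Fin m) = Fin.cons (S j) (S ∘ i) :=
    Fin.comp_cons ..
  change g.indicator 1 (S ∘ Fin.cons j i) = g.indicator 1 (Fin.cons (S j) (S ∘ i))
  rw [hcons]

variable [MeasurableSpace V] (p : Measure V) [IsProbabilityMeasure p]

theorem edgeFreq_mem_Icc (g : Set (Fin k → V)) : edgeFreq p g ∈ Set.Icc (0 : ℝ) 1 :=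
  ⟨measureReal_nonneg, measureReal_le_one⟩

theorem abs_edgeFreq_sub_empFreq_le_one (g : Set (Fin k → V)) (S : Fin m → V) :
    |edgeFreq p g - empFreq S g| ≤ 1 :=
  abs_sub_le_of_nonneg_of_le (edgeFreq_mem_Icc p g).1 (edgeFreq_mem_Icc p g).2
    (empFreq_mem_Icc S g).1 (empFreq_mem_Icc S g).2

/-- The largest deviation, over the hypergraphs `g a`, of the empirical edge frequency from the
edge frequency. -/
noncomputable def edgeFreqDev (p : Measure V) (g : Γ → Set (Fin k → V)) (S : Fin m → V) : ℝ :=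
  ⨆ a, |edgeFreq p (g a) - empFreq S (g a)|

theorem abs_edgeFreq_sub_empFreq_le_edgeFreqDev (g : Γ → Set (Fin k → V)) (S : Fin m → V) (a : Γ) :
    |edgeFreq p (g a) - empFreq S (g a)| ≤ edgeFreqDev p g S :=
  le_iSup_abs (fun a => abs_edgeFreq_sub_empFreq_le_one p (g a) S) a

theorem abs_edgeFreqDev_le_one (g : Γ → Set (Fin k → V)) (S : Fin m → V) :
    |edgeFreqDev p g S| ≤ 1 :=
  abs_iSup_abs_le zero_le_one fun a => abs_edgeFreq_sub_empFreq_le_one p (g a) S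

theorem abs_edgeFreqDev_sub_update_le (g : Γ → Set (Fin k → V)) (S : Fin m → V) (j : Fin m)
    (x : V) : |edgeFreqDev p g S - edgeFreqDev p g (Function.update S j x)| ≤ k / m := by
  have hle (S T : Fin m → V) (h : ∀ a, |empFreq S (g a) - empFreq T (g a)| ≤ k / m) :
      edgeFreqDev p g S ≤ edgeFreqDev p g T + k / m :=
    iSup_abs_le_iSup_abs_add (by positivity)
      (fun a => abs_edgeFreq_sub_empFreq_le_one p (g a) T) fun a => by
        rw [sub_sub_sub_cancel_left, abs_sub_comm]
        exact h a
  have hupdate (a : Γ) := abs_empFreq_sub_update_le S j x (g a)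
  exact abs_sub_le_iff.2 ⟨sub_le_iff_le_add'.2 (hle _ _ hupdate),
    sub_le_iff_le_add'.2 (hle _ _ fun a => abs_sub_comm (empFreq S (g a)) _ ▸ hupdate a)⟩

theorem edgeFreqDev_fin_zero (g : Γ → Set (Fin 0 → V)) (S : Fin m → V) :
    edgeFreqDev p g S = 0 := by
  have hterm (a : Γ) : edgeFreq p (g a) = empFreq S (g a) := by
    rcases (g a).eq_empty_or_nonempty with h | h
    · simp [edgeFreq, empFreq, h]
    · simp [edgeFreq, empFreq, Subsingleton.eq_univ_of_nonempty h]
  simp [edgeFreqDev, hterm]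

variable [Countable V] [MeasurableSingletonClass V]

theorem edgeFreq_eq_integral_fixFirst (g : Set (Fin (k + 1) → V)) :
    edgeFreq p g = ∫ v, edgeFreq p (fixFirst v g) ∂p := by
  have he := (measurePreserving_piFinSuccAbove (fun _ : Fin (k + 1) => p) 0).symm
  have hsection (v : V) : Prod.mk v ⁻¹'
      ((MeasurableEquiv.piFinSuccAbove (fun _ : Fin (k + 1) => V) 0).symm ⁻¹' g) =
        fixFirst v g := by
    ext u
    simp [fixFirst, MeasurableEquiv.piFinSuccAbove, Fin.consEquiv]
  simp only [edgeFreq, measureReal_def]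
  rw [← he.measure_preimage (MeasurableSet.of_discrete.nullMeasurableSet),
    Measure.prod_apply .of_discrete, ← integral_toReal Measurable.of_discrete.aemeasurable
      (.of_forall fun _ => measure_lt_top _ _)]
  simp only [hsection]

theorem integral_empFreq_fixFirst (S : Fin m → V) (g : Set (Fin (k + 1) → V)) :
    ∫ v, empFreq S (fixFirst v g) ∂p =
      (∑ i : Fin k → Fin m, p.real (fixTail (S ∘ i) g)) / (m : ℝ) ^ k := by
  simp only [empFreq]
  rw [integral_div, integral_finsetSum _ fun i _ => ?_]
  · congr! with i
    exact integral_indicator_one .of_discrete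
  · refine integrable_of_forall_abs_le (C := 1) fun v => ?_
    by_cases h : (fun l => S (i l)) ∈ fixFirst v g <;> simp [h]

theorem edgeFreq_sub_empFreq_eq (g : Set (Fin (k + 1) → V)) (S : Fin m → V) :
    edgeFreq p g - empFreq S g =
      ∫ v, (edgeFreq p (fixFirst v g) - empFreq S (fixFirst v g)) ∂p +
        (∑ i : Fin k → Fin m, (p.real (fixTail (S ∘ i) g) - freq S (fixTail (S ∘ i) g))) /
          (m : ℝ) ^ k := by
  have hint {f : V → ℝ} (hf : ∀ v, f v ∈ Set.Icc (0 : ℝ) 1) : Integrable f p :=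
    integrable_of_forall_abs_le fun v => (abs_of_nonneg (hf v).1).trans_le (hf v).2
  rw [integral_sub (hint fun v => edgeFreq_mem_Icc p _) (hint fun v => empFreq_mem_Icc S _),
    ← edgeFreq_eq_integral_fixFirst, integral_empFreq_fixFirst, sum_sub_distrib, sub_div,
    ← empFreq_eq_sum_freq_fixTail]
  ring

theorem edgeFreqDev_succ_le (g : Γ → Set (Fin (k + 1) → V)) (S : Fin m → V) :
    edgeFreqDev p g S ≤ ∫ v, edgeFreqDev p (fixFirst v ∘ g) S ∂p +
      (∑ i : Fin k → Fin m, uniformDev p (fixTail (S ∘ i) ∘ g) S) / (m : ℝ) ^ k := by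
  have hfix (a : Γ) (v : V) := abs_edgeFreq_sub_empFreq_le_one p (fixFirst v (g a)) S
  refine Real.iSup_le (fun a => ?_) (add_nonneg
    (integral_nonneg fun v => Real.iSup_nonneg fun a => abs_nonneg _)
    (div_nonneg (sum_nonneg fun i _ => uniformDev_nonneg p _ S) (by positivity)))
  rw [edgeFreq_sub_empFreq_eq]
  refine (abs_add_le _ _).trans (add_le_add ?_ ?_)
  · exact abs_integral_le_integral_iSup_abs zero_le_one hfix a
  · rw [abs_div, abs_of_nonneg (by positivity : (0 : ℝ) ≤ (m : ℝ) ^ k)]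
    gcongr
    exact (abs_sum_le_sum_abs _ _).trans (sum_le_sum fun i _ =>
      abs_measureReal_sub_freq_le_uniformDev p (fixTail (S ∘ i) ∘ g) S a)

end EdgeFrequencies

section GraphVCDimension

variable {V Γ : Type*} {k : ℕ}

theorem Undirected.cons_cons_mem_iff {g : Set (Fin (k + 2) → V)} (hg : Undirected g) (x y : V)
    (u : Fin k → V) :
    (Fin.cons x (Fin.cons y u) : Fin (k + 2) → V) ∈ g ↔
      (Fin.cons y (Fin.cons x u) : Fin (k + 2) → V) ∈ g := by
  rw [← hg (Equiv.swap 0 1)]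
  congr! 1
  funext i
  refine Fin.cases ?_ (fun i => Fin.cases ?_ (fun i => ?_) i) i
  · simp
  · simp
  · rw [Equiv.swap_apply_of_ne_of_ne (by simp) (by simp [Fin.ext_iff])]
    rfl

theorem Undirected.fixFirst {g : Set (Fin (k + 1) → V)} (hg : Undirected g) (v : V) :
    Undirected (fixFirst v g) := by
  intro π u
  rw [GraphDisc.fixFirst, Set.mem_ofPred_eq, Set.mem_ofPred_eq,
    ← hg (Equiv.Perm.decomposeFin.symm (0, π)) (Fin.cons v u)]
  congr! 1
  funext i
  refine Fin.cases ?_ (fun i => ?_) i <;> simp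

theorem gVC_image_fixFirst_le (v : V) (G : Set (Set (Fin (k + 1) → V))) :
    gVC k (fixFirst v '' G) ≤ gVC (k + 1) G := by
  cases k with
  | zero => exact zero_le
  | succ k => exact le_iSup (fun v => gVC (k + 1) (fixFirst v '' G)) v

theorem VCdim_fixTail_le_gVC {g : Γ → Set (Fin (k + 1) → V)} (hg : ∀ a, Undirected (g a))
    (u : Fin k → V) : VCdim (Set.range (fixTail u ∘ g)) ≤ gVC (k + 1) (Set.range g) := by
  induction k with
  | zero =>
    have hcons (x : V) : (Fin.cons x u : Fin (0 + 1) → V) = fun _ => x := by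
      funext i
      rw [Fin.fin_one_eq_zero i, Fin.cons_zero]
    rw [Set.range_comp]
    unfold fixTail
    simp only [hcons]
    exact le_rfl
  | succ k ih =>
    have hswap : fixTail u ∘ g = fixTail (Fin.tail u) ∘ fixFirst (u 0) ∘ g := by
      funext a
      ext x
      change _ ↔ (Fin.cons (u 0) (Fin.cons x (Fin.tail u)) : Fin (k + 2) → V) ∈ g a
      rw [(hg a).cons_cons_mem_iff, Fin.cons_self_tail]
      rfl
    calc VCdim (Set.range (fixTail u ∘ g))
        = VCdim (Set.range (fixTail (Fin.tail u) ∘ fixFirst (u 0) ∘ g)) := by rw [hswap]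
      _ ≤ gVC (k + 1) (fixFirst (u 0) '' Set.range g) := by
          rw [← Set.range_comp]
          exact ih (fun a => (hg a).fixFirst (u 0)) (Fin.tail u)
      _ ≤ gVC (k + 2) (Set.range g) := gVC_image_fixFirst_le (u 0) _

theorem subsingleton_of_VCdim_eq_zero {D : Set (Set V)} (hD : VCdim D = 0) : D.Subsingleton := by
  suffices hsub : ∀ A ∈ D, ∀ B ∈ D, A ⊆ B from fun A hA B hB =>
    (hsub A hA B hB).antisymm (hsub B hB A hA)
  intro A hA B hB x hxA
  by_contra hxB
  have hshatter : ShattersSet D {x} := by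
    intro T hT
    rw [coe_singleton] at hT ⊢
    rcases Set.subset_singleton_iff_eq.1 hT with rfl | rfl
    · exact ⟨B, hB, Set.inter_singleton_eq_empty.2 hxB⟩
    · exact ⟨A, hA, Set.inter_eq_right.2 (Set.singleton_subset_iff.2 hxA)⟩
  simpa [hD] using card_le_VCdim hshatter

theorem subsingleton_of_gVC_eq_zero (hk : 1 ≤ k) {G : Set (Set (Fin k → V))}
    (hG : IsDistinguishingClass G) (h : gVC k G = 0) : G.Subsingleton := by
  obtain ⟨k, rfl⟩ := Nat.exists_eq_add_of_le' hk
  intro g hg g' hg'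
  ext w
  have hle := VCdim_fixTail_le_gVC (fun a : G => hG a a.2) (Fin.tail w)
  rw [Subtype.range_coe, h, nonpos_iff_eq_zero] at hle
  have htail : fixTail (Fin.tail w) g = fixTail (Fin.tail w) g' :=
    subsingleton_of_VCdim_eq_zero hle ⟨⟨g, hg⟩, rfl⟩ ⟨⟨g', hg'⟩, rfl⟩
  simpa only [fixTail, Set.mem_ofPred_eq, Fin.cons_self_tail] using Set.ext_iff.1 htail (w 0)

end GraphVCDimension

section ExpectedDeviation

variable {V Γ : Type*} [Countable V] [MeasurableSpace V] [MeasurableSingletonClass V] {m d : ℕ}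
  [NeZero m] (p : Measure V) [IsProbabilityMeasure p]

theorem integral_avg_uniformDev_fixTail_le {k : ℕ} (hd : 1 ≤ d) {g : Γ → Set (Fin (k + 1) → V)}
    (hg : ∀ a, Undirected (g a)) (hgVC : gVC (k + 1) (Set.range g) ≤ d) :
    ∫ S, (∑ i : Fin k → Fin m, uniformDev p (fixTail (S ∘ i) ∘ g) S) / (m : ℝ) ^ k
        ∂(Measure.pi fun _ => p) ≤ 72 * √(d / m) + k / m := by
  have hm : (0 : ℝ) < m := Nat.cast_pos.2 (NeZero.pos m)
  rw [integral_div, integral_finsetSum _ fun i _ =>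
    integrable_of_forall_abs_le fun S => abs_uniformDev_le_one p _ S, div_le_iff₀ (by positivity)]
  calc _ ≤ ∑ _i : Fin k → Fin m, (72 * √(d / m) + k / m) := sum_le_sum fun i _ => by
        simpa only [Fintype.card_fin] using integral_uniformDev_comp_le p hd
          (D := fun u => fixTail u ∘ g) (fun u => (VCdim_fixTail_le_gVC hg u).trans hgVC) i
    _ = (72 * √(d / m) + k / m) * (m : ℝ) ^ k := by
        simp only [sum_const, card_univ, Fintype.card_fun, Fintype.card_fin, nsmul_eq_mul]
        push_cast
        ring

theorem integral_edgeFreqDev_le {k : ℕ} (hd : 1 ≤ d) {g : Γ → Set (Fin k → V)}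
    (hg : ∀ a, Undirected (g a)) (hgVC : gVC k (Set.range g) ≤ d) :
    ∫ S : Fin m → V, edgeFreqDev p g S ∂(Measure.pi fun _ => p) ≤
      k * (72 * √(d / m) + k / m) := by
  induction k with
  | zero => simp [edgeFreqDev_fin_zero]
  | succ k ih =>
    set P : Measure (Fin m → V) := Measure.pi fun _ => p
    have hfix (v : V) : ∫ S, edgeFreqDev p (fixFirst v ∘ g) S ∂P ≤ k * (72 * √(d / m) + k / m) :=
      ih (fun a => (hg a).fixFirst v)
        (Set.range_comp (fixFirst v) g ▸ (gVC_image_fixFirst_le v _).trans hgVC)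
    have hswap : Integrable (fun q : (Fin m → V) × V => edgeFreqDev p (fixFirst q.2 ∘ g) q.1)
        (P.prod p) := integrable_of_forall_abs_le fun q => abs_edgeFreqDev_le_one p _ q.1
    have htail : Integrable (fun S : Fin m → V =>
        (∑ i : Fin k → Fin m, uniformDev p (fixTail (S ∘ i) ∘ g) S) / (m : ℝ) ^ k) P :=
      (integrable_finsetSum _ fun i _ =>
        integrable_of_forall_abs_le fun S => abs_uniformDev_le_one p _ S).div_const _
    calc ∫ S, edgeFreqDev p g S ∂P
        ≤ ∫ S, (∫ v, edgeFreqDev p (fixFirst v ∘ g) S ∂p +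
            (∑ i : Fin k → Fin m, uniformDev p (fixTail (S ∘ i) ∘ g) S) / (m : ℝ) ^ k) ∂P :=
          integral_mono (integrable_of_forall_abs_le (abs_edgeFreqDev_le_one p g))
            (hswap.integral_prod_left.add htail) (edgeFreqDev_succ_le p g)
      _ ≤ k * (72 * √(d / m) + k / m) + (72 * √(d / m) + k / m) := by
          rw [integral_add hswap.integral_prod_left htail, integral_integral_swap hswap]
          exact add_le_add (integral_le_of_forall_le hswap.integral_prod_right hfix)
            (integral_avg_uniformDev_fixTail_le p hd hg hgVC)
      _ = (k + 1 : ℕ) * (72 * √(d / m) + k / m) := by push_cast; ring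
      _ ≤ (k + 1 : ℕ) * (72 * √(d / m) + (k + 1 : ℕ) / m) := by gcongr; exact k.le_succ

end ExpectedDeviation

section HighProbability

variable {V Γ : Type*} [Countable V] [MeasurableSpace V] [MeasurableSingletonClass V] {k m d : ℕ}
  [NeZero m] (p : Measure V) [IsProbabilityMeasure p] {g : Γ → Set (Fin k → V)} {ε δ : ℝ}

theorem measureReal_integral_add_le_edgeFreqDev_le (g : Γ → Set (Fin k → V)) {s : ℝ} (hs : 0 ≤ s) :
    (Measure.pi fun _ : Fin m => p).real
        {S | ∫ T, edgeFreqDev p g T ∂(Measure.pi fun _ : Fin m => p) + s ≤ edgeFreqDev p g S} ≤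
      Real.exp (-(2 * s ^ 2 * m / k ^ 2)) := by
  have hm : (m : ℝ) ≠ 0 := Nat.cast_ne_zero.2 (NeZero.ne m)
  have htail := (hasSubgaussianMGF_of_bounded_differences (fun _ : Fin m => p)
    (f := edgeFreqDev p g) .of_discrete (c := fun _ => k / m) fun S j x => by
      simpa using abs_edgeFreqDev_sub_update_le p g S j x).measure_ge_le hs
  simp only [le_sub_iff_add_le'] at htail
  refine htail.trans_eq (congrArg Real.exp ?_)
  simp only [sum_const, card_univ, Fintype.card_fin, nsmul_eq_mul]
  push_cast
  field_simp

theorem integral_edgeFreqDev_le_half (hd : 1 ≤ d) (hg : ∀ a, Undirected (g a))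
    (hgVC : gVC k (Set.range g) ≤ d) (hε : 0 < ε) (hε1 : ε ≤ 1)
    (hm : 288 ^ 2 * (d * k ^ 2 : ℝ) ≤ ε ^ 2 * m) :
    ∫ S, edgeFreqDev p g S ∂(Measure.pi fun _ : Fin m => p) ≤ ε / 2 := by
  have hm0 : (0 : ℝ) < m := Nat.cast_pos.2 (NeZero.pos m)
  have hd1 : (1 : ℝ) ≤ d := Nat.one_le_cast.2 hd
  have hchain : k * √(d / m) ≤ ε / 288 := by
    refine abs_le_of_sq_le_sq' ?_ (by positivity) |>.2
    rw [mul_pow, Real.sq_sqrt (by positivity), div_pow, mul_div_assoc', div_le_div_iff₀ hm0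
      (by positivity)]
    linarith
  have hrepeat : (k : ℝ) * (k / m) ≤ ε / 4 := by
    rw [mul_div_assoc', div_le_iff₀ hm0]
    have hkd : (k : ℝ) ^ 2 ≤ d * k ^ 2 := le_mul_of_one_le_left (by positivity) hd1
    have hεm : ε ^ 2 * m ≤ ε * m := by
      gcongr
      exact pow_le_of_le_one hε.le hε1 two_ne_zero
    nlinarith
  linarith [integral_edgeFreqDev_le (m := m) p hd hg hgVC]

theorem measureReal_le_edgeFreqDev_le (hk : 1 ≤ k) (hd : 1 ≤ d) (hg : ∀ a, Undirected (g a))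
    (hgVC : gVC k (Set.range g) ≤ d) (hε : 0 < ε) (hδ : 0 < δ) (hδ2 : δ ≤ 1 / 2)
    (hm : 120000 * (d * k ^ 2 / ε ^ 2 * Real.log (1 / δ)) ≤ m) :
    (Measure.pi fun _ : Fin m => p).real {S | ε ≤ edgeFreqDev p g S} ≤ δ := by
  rcases lt_or_ge 1 ε with hε1 | hε1
  · have hempty : {S : Fin m → V | ε ≤ edgeFreqDev p g S} = ∅ :=
      Set.eq_empty_of_forall_notMem fun S hS =>
        (hε1.trans_le (le_trans hS (le_of_abs_le (abs_edgeFreqDev_le_one p g S)))).false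
    simpa [hempty] using hδ.le
  have hk2 : (0 : ℝ) < k ^ 2 := by positivity
  have hd1 : (1 : ℝ) ≤ d := Nat.one_le_cast.2 hd
  have hlog : Real.log 2 ≤ Real.log (1 / δ) :=
    Real.log_le_log two_pos (by rw [le_div_iff₀ hδ]; linarith)
  have hsize : 120000 * (d * k ^ 2 * Real.log (1 / δ)) ≤ ε ^ 2 * m := by
    rw [div_mul_eq_mul_div, mul_div_assoc', div_le_iff₀ (by positivity)] at hm
    linarith
  have hdk : (k : ℝ) ^ 2 ≤ d * k ^ 2 := le_mul_of_one_le_left hk2.le hd1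
  have hmean : ∫ S, edgeFreqDev p g S ∂(Measure.pi fun _ : Fin m => p) ≤ ε / 2 :=
    integral_edgeFreqDev_le_half p hd hg hgVC hε hε1 <| by
      nlinarith [Real.log_two_gt_d9]
  have hexponent : Real.log (1 / δ) ≤ 2 * (ε / 2) ^ 2 * m / k ^ 2 := by
    rw [le_div_iff₀ hk2]
    nlinarith [Real.log_two_gt_d9]
  calc (Measure.pi fun _ : Fin m => p).real {S | ε ≤ edgeFreqDev p g S}
      ≤ (Measure.pi fun _ : Fin m => p).real {S |
          ∫ T, edgeFreqDev p g T ∂(Measure.pi fun _ : Fin m => p) + ε / 2 ≤ edgeFreqDev p g S} :=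
        measureReal_mono fun S (hS : ε ≤ _) => (by linarith : _ + ε / 2 ≤ edgeFreqDev p g S)
    _ ≤ Real.exp (-(2 * (ε / 2) ^ 2 * m / k ^ 2)) :=
        measureReal_integral_add_le_edgeFreqDev_le p g (by positivity)
    _ ≤ Real.exp (-Real.log (1 / δ)) := Real.exp_le_exp.2 (neg_le_neg hexponent)
    _ = δ := by rw [one_div, Real.log_inv, neg_neg, Real.exp_log hδ]

end HighProbability

section Discrimination

variable {V : Type*} {k m : ℕ} {G : Set (Set (Fin k → V))} {A : Algo V k} {ε δ M : ℝ}

theorem finite_range_empFreq (S : Fin m → V) :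
    (Set.range fun g : Set (Fin k → V) => empFreq S g).Finite := by
  refine (Set.finite_range fun T : Set (Fin k → Fin m) =>
    (∑ i, T.indicator (fun _ => (1 : ℝ)) i) / (m : ℝ) ^ k).subset ?_
  rintro _ ⟨g, rfl⟩
  exact ⟨{i | S ∘ i ∈ g}, rfl⟩

theorem exists_isEmpiricalMaximizer (hG : G.Nonempty) :
    ∃ A : Algo V k, IsEmpiricalMaximizer G A := by
  have hmax (m₁ m₂ : ℕ) (S₁ : Fin m₁ → V) (S₂ : Fin m₂ → V) : ∃ g₀ ∈ G, ∀ g ∈ G,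
      |empFreq S₁ g - empFreq S₂ g| ≤ |empFreq S₁ g₀ - empFreq S₂ g₀| := by
    have hfin : ((fun g => |empFreq S₁ g - empFreq S₂ g|) '' G).Finite := by
      refine (((finite_range_empFreq (k := k) S₁).prod (finite_range_empFreq (k := k) S₂)).image
        fun q => |q.1 - q.2|).subset ?_
      rintro _ ⟨g, -, rfl⟩
      exact ⟨(empFreq S₁ g, empFreq S₂ g), ⟨⟨g, rfl⟩, ⟨g, rfl⟩⟩, rfl⟩
    simpa using Set.exists_max_image _ id hfin (hG.image _)
  choose A hA using hmax
  exact ⟨A, hA⟩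

variable [MeasurableSpace V]

theorem sampleComplexity_le_of_discriminates (hM : 0 ≤ M) (hA : Discriminates G A ε δ M) :
    (sampleComplexity G ε δ : ℝ≥0∞) ≤ ENNReal.ofReal M := by
  have hfloor : Discriminates G A ε δ ⌊M⌋₊ :=
    ⟨hA.1, fun p₁ p₂ hp₁ hp₂ m₁ m₂ hm₁ hm₂ => hA.2 p₁ p₂ hp₁ hp₂ m₁ m₂
      (Nat.lt_of_floor_lt (Nat.cast_lt.1 hm₁)) (Nat.lt_of_floor_lt (Nat.cast_lt.1 hm₂))⟩
  have hle : sampleComplexity G ε δ ≤ ⌊M⌋₊ := iInf₂_le ⌊M⌋₊ ⟨A, hfloor⟩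
  calc (sampleComplexity G ε δ : ℝ≥0∞) ≤ ((⌊M⌋₊ : ℕ∞) : ℝ≥0∞) := ENat.toENNReal_mono hle
    _ = ENNReal.ofReal ⌊M⌋₊ := by rw [ENat.toENNReal_coe, ENNReal.ofReal_natCast]
    _ ≤ ENNReal.ofReal M := ENNReal.ofReal_le_ofReal (Nat.floor_le hM)

theorem IPM_singleton (g : Set (Fin k → V)) (p₁ p₂ : Measure V) :
    IPM {g} p₁ p₂ = |edgeFreq p₁ g - edgeFreq p₂ g| :=
  ciSup_unique

section Bounds

variable (p₁ p₂ : Measure V) [IsProbabilityMeasure p₁] [IsProbabilityMeasure p₂] {m₁ m₂ : ℕ}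

theorem abs_abs_edgeFreq_sub_sub_abs_empFreq_sub_le (S₁ : Fin m₁ → V) (S₂ : Fin m₂ → V) (g : G) :
    |(|edgeFreq p₁ g.1 - edgeFreq p₂ g.1| - |empFreq S₁ g.1 - empFreq S₂ g.1|)| ≤
      edgeFreqDev p₁ (fun g : G => g.1) S₁ + edgeFreqDev p₂ (fun g : G => g.1) S₂ := by
  refine (abs_abs_sub_abs_le _ _).trans ?_
  rw [sub_sub_sub_comm]
  exact (abs_sub _ _).trans (add_le_add
    (abs_edgeFreq_sub_empFreq_le_edgeFreqDev p₁ (fun g : G => g.1) S₁ g)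
    (abs_edgeFreq_sub_empFreq_le_edgeFreqDev p₂ (fun g : G => g.1) S₂ g))

theorem IsEmpiricalMaximizer.IPM_le (hA : IsEmpiricalMaximizer G A) (S₁ : Fin m₁ → V)
    (S₂ : Fin m₂ → V) :
    IPM G p₁ p₂ ≤ |edgeFreq p₁ (A m₁ m₂ S₁ S₂) - edgeFreq p₂ (A m₁ m₂ S₁ S₂)| +
      2 * (edgeFreqDev p₁ (fun g : G => g.1) S₁ + edgeFreqDev p₂ (fun g : G => g.1) S₂) := by
  obtain ⟨hmem, hmax⟩ := hA m₁ m₂ S₁ S₂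
  have : Nonempty G := ⟨⟨_, hmem⟩⟩
  refine ciSup_le fun g => ?_
  have hclose (g : G) := abs_le.1 (abs_abs_edgeFreq_sub_sub_abs_empFreq_sub_le p₁ p₂ S₁ S₂ g)
  linarith [hmax g g.2, (hclose g).2, (hclose ⟨_, hmem⟩).1]

theorem one_sub_add_le_measureReal_compl_prod {α β : Type*} [MeasurableSpace α]
    [MeasurableSpace β] (μ : Measure α) (ν : Measure β) [IsProbabilityMeasure μ]
    [IsProbabilityMeasure ν] {s : Set α} {t : Set β} (hs : MeasurableSet s)
    (ht : MeasurableSet t) : 1 - (μ.real s + ν.real t) ≤ (μ.prod ν).real (sᶜ ×ˢ tᶜ) := by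
  rw [measureReal_prod_prod, probReal_compl_eq_one_sub hs, probReal_compl_eq_one_sub ht]
  nlinarith [mul_nonneg (measureReal_nonneg (μ := μ) (s := s))
    (measureReal_nonneg (μ := ν) (s := t))]

variable [Countable V] [MeasurableSingletonClass V]

theorem IsEmpiricalMaximizer.one_sub_le_measureReal (hA : IsEmpiricalMaximizer G A)
    (h₁ : (Measure.pi fun _ : Fin m₁ => p₁).real
      {S | ε / 4 ≤ edgeFreqDev p₁ (fun g : G => g.1) S} ≤ δ / 2)
    (h₂ : (Measure.pi fun _ : Fin m₂ => p₂).real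
      {S | ε / 4 ≤ edgeFreqDev p₂ (fun g : G => g.1) S} ≤ δ / 2) :
    1 - δ ≤ ((Measure.pi fun _ : Fin m₁ => p₁).prod (Measure.pi fun _ : Fin m₂ => p₂)).real
      {S | IPM G p₁ p₂ - ε < |edgeFreq p₁ (A m₁ m₂ S.1 S.2) - edgeFreq p₂ (A m₁ m₂ S.1 S.2)|} := by
  refine le_trans (by linarith) ((one_sub_add_le_measureReal_compl_prod
    (Measure.pi fun _ : Fin m₁ => p₁) (Measure.pi fun _ : Fin m₂ => p₂)
    (s := {S | ε / 4 ≤ edgeFreqDev p₁ (fun g : G => g.1) S})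
    (t := {S | ε / 4 ≤ edgeFreqDev p₂ (fun g : G => g.1) S}) .of_discrete .of_discrete).trans
    (measureReal_mono fun S hS => ?_))
  have hS₁ : edgeFreqDev p₁ (fun g : G => g.1) S.1 < ε / 4 := not_le.1 hS.1
  have hS₂ : edgeFreqDev p₂ (fun g : G => g.1) S.2 < ε / 4 := not_le.1 hS.2
  have hIPM := hA.IPM_le p₁ p₂ S.1 S.2
  exact (by linarith : IPM G p₁ p₂ - ε < _)

end Bounds

theorem log_one_div_half_le (hδ : 0 < δ) (hδ2 : δ ≤ 1 / 2) :
    Real.log (1 / (δ / 2)) ≤ 2 * Real.log (1 / δ) := by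
  rw [← Real.log_rpow (by positivity), Real.rpow_two]
  refine Real.log_le_log (by positivity) ?_
  rw [one_div_pow, one_div_le_one_div (by positivity) (by positivity)]
  nlinarith

theorem IsEmpiricalMaximizer.discriminates [Countable V] [MeasurableSingletonClass V]
    (hA : IsEmpiricalMaximizer G A) (hk : 1 ≤ k) (hG : IsDistinguishingClass G) {ρ : ℕ}
    (hρ : gVC k G = ρ) (hε : 0 < ε) (hδ : 0 < δ) (hδ2 : δ ≤ 1 / 2) :
    Discriminates G A ε δ (3840000 * (ρ * k ^ 2 / ε ^ 2 * Real.log (1 / δ))) := by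
  refine ⟨fun m₁ m₂ S₁ S₂ => (hA m₁ m₂ S₁ S₂).1, fun p₁ p₂ hp₁ hp₂ m₁ m₂ hm₁ hm₂ => ?_⟩
  rcases ρ.eq_zero_or_pos with rfl | hρ1
  · have hsingle (S : (Fin m₁ → V) × (Fin m₂ → V)) : G = {A m₁ m₂ S.1 S.2} :=
      (subsingleton_of_gVC_eq_zero hk hG hρ).eq_singleton_of_mem (hA m₁ m₂ S.1 S.2).1
    have hall (S : (Fin m₁ → V) × (Fin m₂ → V)) : IPM G p₁ p₂ - ε <
        |edgeFreq p₁ (A m₁ m₂ S.1 S.2) - edgeFreq p₂ (A m₁ m₂ S.1 S.2)| := by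
      rw [← IPM_singleton, ← hsingle S]
      linarith
    simpa [hall] using hδ.le
  · have hdev (p : Measure V) [IsProbabilityMeasure p] {m : ℕ}
        (hm : 3840000 * (ρ * k ^ 2 / ε ^ 2 * Real.log (1 / δ)) < m) :
        (Measure.pi fun _ : Fin m => p).real
          {S | ε / 4 ≤ edgeFreqDev p (fun g : G => g.1) S} ≤ δ / 2 := by
      have hlog : 0 ≤ Real.log (1 / δ) := Real.log_nonneg (one_le_one_div hδ (by linarith))
      have : NeZero m := ⟨Nat.cast_ne_zero.1 (lt_of_le_of_lt (by positivity) hm).ne'⟩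
      refine measureReal_le_edgeFreqDev_le p hk hρ1 (fun g => hG g g.2)
        (by rw [Subtype.range_coe, hρ]) (by positivity) (by positivity) (by linarith) ?_
      calc 120000 * (ρ * k ^ 2 / (ε / 4) ^ 2 * Real.log (1 / (δ / 2)))
          ≤ 120000 * (ρ * k ^ 2 / (ε / 4) ^ 2 * (2 * Real.log (1 / δ))) := by
            gcongr
            exact log_one_div_half_le hδ hδ2
        _ = 3840000 * (ρ * k ^ 2 / ε ^ 2 * Real.log (1 / δ)) := by ring
        _ ≤ m := hm.le
    exact hA.one_sub_le_measureReal p₁ p₂ (hdev p₁ hm₁) (hdev p₂ hm₂)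

end Discrimination

end GraphDisc

theorem mainTheorem5 :
    ∃ C : ℝ, 0 < C ∧
      ∀ (V : Type*) [Countable V] [MeasurableSpace V] [MeasurableSingletonClass V]
        (k : ℕ) (_ : 1 ≤ k) (G : Set (Set (Fin k → V))) (_ : G.Nonempty)
        (_ : GraphDisc.IsDistinguishingClass G) (ρ : ℕ) (_ : GraphDisc.gVC k G = (ρ : ℕ∞)),
        (∀ ε δ : ℝ, 0 < ε → 0 < δ → δ ≤ 1 / 2 →
          ((GraphDisc.sampleComplexity G ε δ : ℕ∞) : ℝ≥0∞) ≤
            ENNReal.ofReal (C * ((ρ : ℝ) * (k : ℝ) ^ 2 / ε ^ 2 * Real.log (1 / δ)))) ∧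
        (∃ A : GraphDisc.Algo V k, GraphDisc.IsEmpiricalMaximizer G A) ∧
        (∀ A : GraphDisc.Algo V k, GraphDisc.IsEmpiricalMaximizer G A →
          ∀ ε δ : ℝ, 0 < ε → 0 < δ → δ ≤ 1 / 2 →
            GraphDisc.Discriminates G A ε δ
              (C * ((ρ : ℝ) * (k : ℝ) ^ 2 / ε ^ 2 * Real.log (1 / δ)))) := by
  refine ⟨3840000, by norm_num, fun V _ _ _ k hk G hG hGu ρ hρ => ?_⟩
  have hdisc (A : GraphDisc.Algo V k) (hA : GraphDisc.IsEmpiricalMaximizer G A) (ε δ : ℝ)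
      (hε : 0 < ε) (hδ : 0 < δ) (hδ2 : δ ≤ 1 / 2) :=
    hA.discriminates hk hGu hρ hε hδ hδ2
  obtain ⟨A, hA⟩ := GraphDisc.exists_isEmpiricalMaximizer hG
  refine ⟨fun ε δ hε hδ hδ2 => ?_, ⟨A, hA⟩, hdisc⟩
  have hlog : 0 ≤ Real.log (1 / δ) := Real.log_nonneg (one_le_one_div hδ (by linarith))
  exact GraphDisc.sampleComplexity_le_of_discriminates (by positivity) (hdisc A hA ε δ hε hδ hδ2)
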